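/- Let $X$ be a locally compact Polish space, $\mathbb R_+^*=(0,\infty)$ with the metric $|\ln s_1-\ln s_2|$, and $\hat X=\mathbb R_+^*\times X$. Let $\mathcal B_c(X)$ be the family of Borel sets with compact closure. Let $\mathbb K(X)$ be the cone of discrete Radon measures $\eta=\sum_i s_i\delta_{x_i}$ on $X$ (at most countably many distinct atoms $x_i$, weights $s_i>0$), with the Borel $\sigma$-algebra of the vague topology. Write $s_x(\eta)=\eta(\{x\})$ and $\tau(\eta)=\{x: s_x(\eta)>0\}$, and let $\mathbb K_0(X)=\{\eta\in\mathbb K(X): |\tau(\eta)|<\infty\}$. Let $\Gamma(\hat X)$ be the space of locally finite configurations $\gamma\subset\hat X$, with the Borel $\sigma$-algebra of the vague topology. Let $\Pi(\hat X)\subset\Gamma(\hat X)$ be the set of those $\gamma$ for which $(s_1,x),(s_2,x)\in\gamma$ implies $s_1=s_2$ and $\sum_{(s,x)\in\gamma}s\,1_\Lambda(x)<\infty$ for all $\Lambda\in\mathcal B_c(X)$. The map $\mathcal R(\gamma)=\sum_{(s,x)\in\gamma}s\delta_x$ is a bijection from $\Pi(\hat X)$ onto $\mathbb K(X)$. It maps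 the finite configurations $\Pi_0(\hat X)$ in $\Pi(\hat X)$ onto $\mathbb K_0(X)$, and $\mathbb K_0(X)$ carries the $\sigma$-algebra transported by $\mathcal R$ from $\Pi_0(\hat X)$. Here $\Pi_0(\hat X)$ has the trace of the Borel $\sigma$-algebra of the space of finite configurations, which is the topological disjoint union over $n\ge 0$ of the quotients of the sets of $n$-tuples of distinct points of $\hat X$ by the permutations. Let $\nu$ and $\sigma$ be non-atomic positive Radon measures on $\mathbb R_+^*$ and $X$, respectively, and assume that $\int_{\mathbb R_+^*}s^n\,d\nu(s)<\infty$ for all $n\ge1$. Let $\pi_{\nu\otimes\sigma}$ be the Poisson measure on $\Gamma(\hat X)$ with intensity $\nu\otimes\sigma$, that is, the probability measure under which the numbers of points in pairwise disjoint $B_1,\dots,B_k\in\mathcal B_c(\hat X)$ are independent and Poisson distributed with means $(\nu\otimes\sigma)(B_i)$. Let $\pi_{\mathbb K,\nu\otimes\sigma}$ be the push-forward under $\mathcal R$ of the restriction of $\pi_{\nu\otimes\sigma}$ to $\Pi(\hat X)$. Let $\lambda_{\mathbb K_0,\nu\otimes\sigma}$ be the Lebesgue–Poisson measure on $\mathbb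 K_0(X)$, given by $$\int G\,d\lambda_{\mathbb K_0,\nu\otimes\sigma}=G(0)+\sum_{n\ge1}\frac1{n!}\int_{\hat X^n}G\Bigl(\sum_{i=1}^n s_i\delta_{x_i}\Bigr)d\nu(s_1)\cdots d\nu(s_n)\,d\sigma(x_1)\cdots d\sigma(x_n)$$ for measurable $G\ge0$. A measurable set $A\subset\mathbb K_0(X)$ is called bounded if there are $0<a<b$, $\Lambda\in\mathcal B_c(X)$ and $N\in\mathbb N$ such that $\tau(\eta)\subset\Lambda$, $|\tau(\eta)|\le N$ and $s_x(\eta)\in[a,b]$ for all $\eta\in A$ and $x\in\tau(\eta)$. For such $A$ and $\eta\in\mathbb K(X)$ put $(K1_A)(\eta)=\sum_{\xi\Subset\eta}1_A(\xi)$, where $\xi\Subset\eta$ means that $\xi\in\mathbb K_0(X)$, $\tau(\xi)\subset\tau(\eta)$ and $s_x(\xi)=s_x(\eta)$ for $x\in\tau(\xi)$. For a probability measure $\mu$ on $\mathbb K(X)$ with $\int\eta(\Lambda)^n\,d\mu(\eta)<\infty$ for all $n\ge1$ and $\Lambda\in\mathcal B_c(X)$, the correlation measure of $\mu$ is the unique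 measure $\rho_\mu$ on $\mathbb K_0(X)$ with $\rho_\mu(A)=\int_{\mathbb K(X)}K1_A\,d\mu$, the integral being finite, for all bounded $A$. **Proposition.** The measure $\pi_{\mathbb K,\nu\otimes\sigma}$ is a probability measure with finite local moments $\int\eta(\Lambda)^n\,d\pi_{\mathbb K,\nu\otimes\sigma}(\eta)<\infty$ of all orders $n\ge1$, for all $\Lambda\in\mathcal B_c(X)$, and its correlation measure is $\lambda_{\mathbb K_0,\nu\otimes\sigma}$. That is, $\lambda_{\mathbb K_0,\nu\otimes\sigma}(A)=\int_{\mathbb K(X)}K1_A\,d\pi_{\mathbb K,\nu\otimes\sigma}<\infty$ for every bounded $A$, and $\lambda_{\mathbb K_0,\nu\otimes\sigma}$ is the only measure on $\mathbb K_0(X)$ with this property. -/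

import Mathlib

open MeasureTheory
open scoped CompactlySupported ENNReal

namespace RadonCone

/-- The half-line `(0, ∞)`. Its subspace topology is the topology of the metric
`|log s₁ - log s₂|`. -/
abbrev PosReal : Type := {s : ℝ // 0 < s}

/-- Borel sets with compact closure. -/
def IsRelCompactBorel {Y : Type*} [TopologicalSpace Y] [MeasurableSpace Y] (B : Set Y) : Prop :=
  MeasurableSet B ∧ IsCompact (closure B)

/-- The vague topology: the coarsest one that makes `m ↦ ∫ f dm` continuous for all continuous
compactly supported `f`. It is only used on sets of Radon measures. -/
noncomputable abbrev vagueTopology (Y : Type*) [TopologicalSpace Y] [MeasurableSpace Y] :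
    TopologicalSpace (Measure Y) :=
  ⨅ f : C_c(Y, ℝ), TopologicalSpace.induced (fun m => ∫ y, f y ∂m) inferInstance

section Configurations

variable (Y : Type*) [TopologicalSpace Y]

/-- Locally finite configurations: sets of points that have finitely many points in every
compact set. -/
@[ext] structure Config where
  carrier : Set Y
  finite_inter : ∀ C : Set Y, IsCompact C → (carrier ∩ C).Finite

variable {Y}

/-- The measure `∑_{y ∈ γ} δ_y`. -/
noncomputable def Config.toMeasure [MeasurableSpace Y] (γ : Config Y) : Measure Y :=
  Measure.sum fun y : γ.carrier => Measure.dirac (y : Y)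

/-- The vague topology on configurations. -/
noncomputable instance [MeasurableSpace Y] : TopologicalSpace (Config Y) :=
  TopologicalSpace.induced Config.toMeasure (vagueTopology Y)

noncomputable instance [MeasurableSpace Y] : MeasurableSpace (Config Y) := borel _

instance [MeasurableSpace Y] : BorelSpace (Config Y) := ⟨rfl⟩

/-- The Poisson measure with intensity `m`: a probability measure on configurations under which the
numbers of points in pairwise disjoint relatively compact Borel sets `B i` are independent Poisson
random variables with means `m (B i)`. -/
def IsPoissonMeasure [MeasurableSpace Y] (m : Measure Y) (P : Measure (Config Y)) : Prop :=
  IsProbabilityMeasure P ∧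
    ∀ (n : ℕ) (B : Fin n → Set Y), (∀ i, IsRelCompactBorel (B i)) →
      Pairwise (fun i j => Disjoint (B i) (B j)) →
      P.map (fun (γ : Config Y) (i : Fin n) => (γ.carrier ∩ B i).ncard) =
        Measure.pi fun i => ProbabilityTheory.poissonMeasure (m (B i)).toNNReal

variable (Y)

/-- Finite configurations. -/
structure FinConfig where
  toConfig : Config Y
  finite : toConfig.carrier.Finite

variable {Y}

/-- The finite configuration `{y₁, …, yₙ}`. -/
def FinConfig.ofTuple (y : Σ n : ℕ, {y : Fin n → Y // Function.Injective y}) : FinConfig Y where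
  toConfig := ⟨Set.range y.2.1, fun _ _ => (Set.finite_range y.2.1).subset Set.inter_subset_left⟩
  finite := Set.finite_range y.2.1

/-- The topology of finite configurations: `n`-point configurations carry the quotient topology
of the `n`-tuples of distinct points modulo permutations, and the sets of `n`-point
configurations, `n = 0, 1, 2, …`, form a topological disjoint union. -/
noncomputable instance : TopologicalSpace (FinConfig Y) :=
  TopologicalSpace.coinduced FinConfig.ofTuple inferInstance

noncomputable instance : MeasurableSpace (FinConfig Y) := borel _

instance : BorelSpace (FinConfig Y) := ⟨rfl⟩

end Configurations

variable {X : Type*} [MeasurableSpace X]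

/-- The measure `∑_{(s,x) ∈ c} s δ_x`. -/
noncomputable def weightedSum (c : Set (PosReal × X)) : Measure X :=
  Measure.sum fun p : c => ENNReal.ofReal (p : PosReal × X).1 • Measure.dirac (p : PosReal × X).2

section Cone

variable [TopologicalSpace X]

variable (X) in
/-- The cone `K(X)` of discrete Radon measures `∑ᵢ sᵢ δ_{xᵢ}` with at most countably many distinct
atoms `xᵢ` and weights `sᵢ > 0`. -/
@[ext] structure Cone where
  toMeasure : Measure X
  lt_top_of_isCompact : ∀ C : Set X, IsCompact C → toMeasure C < ∞
  discrete : ∃ c : Set (PosReal × X), c.Countable ∧ Set.InjOn Prod.snd c ∧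
    toMeasure = weightedSum c

/-- The vague topology on the cone. -/
noncomputable instance : TopologicalSpace (Cone X) :=
  TopologicalSpace.induced Cone.toMeasure (vagueTopology X)

noncomputable instance : MeasurableSpace (Cone X) := borel _

instance : BorelSpace (Cone X) := ⟨rfl⟩

/-- The weight `s_x(η) = η({x})`. -/
noncomputable def Cone.weight (η : Cone X) (x : X) : ℝ := (η.toMeasure {x}).toReal

/-- The support `τ(η) = {x : s_x(η) > 0}`. -/
def Cone.supp (η : Cone X) : Set X := {x | 0 < η.weight x}

/-- Probability measures on the cone with finite local moments of all orders. -/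
def HasFiniteLocalMoments (μ : Measure (Cone X)) : Prop :=
  IsProbabilityMeasure μ ∧ ∀ n : ℕ, 1 ≤ n → ∀ Λ : Set X, IsRelCompactBorel Λ →
    ∫⁻ η, (η.toMeasure Λ) ^ n ∂μ < ∞

variable (X) in
/-- The sub-cone `K₀(X)` of the discrete Radon measures with finite support. -/
structure FinCone where
  toCone : Cone X
  finite : toCone.supp.Finite

/-- `IsPart ξ η` says that `ξ` is a finite part of `η`: every atom of `ξ` is an atom of `η` with
the same weight. -/
def IsPart (ξ : FinCone X) (η : Cone X) : Prop :=
  ξ.toCone.supp ⊆ η.supp ∧ ∀ x ∈ ξ.toCone.supp, ξ.toCone.weight x = η.weight x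

/-- The `K`-transform `(K G)(η) = ∑_{ξ ⋐ η} G(ξ)`, where `G` has local support, so that only
finitely many terms are nonzero. -/
noncomputable def kTransform (G : FinCone X → ℝ) (η : Cone X) : ℝ :=
  ∑ᶠ ξ ∈ {ξ : FinCone X | IsPart ξ η}, G ξ

/-! Pinpointing configurations and the map `R`. -/

/-- The mass `∑_{(s,x) ∈ γ} s 1_Λ(x)`. -/
noncomputable def localMass (γ : Config (PosReal × X)) (Λ : Set X) : ℝ≥0∞ :=
  ∫⁻ p : PosReal × X, ENNReal.ofReal p.1 * Λ.indicator 1 p.2 ∂γ.toMeasure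

variable (X) in
/-- The set of pinpointing configurations with finite local mass. -/
def pinpointing : Set (Config (PosReal × X)) :=
  {γ | (∀ p ∈ γ.carrier, ∀ q ∈ γ.carrier, p.2 = q.2 → p.1 = q.1) ∧
    ∀ Λ : Set X, IsRelCompactBorel Λ → localMass γ Λ < ∞}

variable (X) in
/-- The space `Π` of pinpointing configurations with finite local mass, with the trace
`σ`-algebra. -/
abbrev PinConfig : Type _ := {γ : Config (PosReal × X) // γ ∈ pinpointing X}

variable (X) in
/-- The space `Π₀` of finite pinpointing configurations, with the trace `σ`-algebra of that of all
finite configurations. -/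
abbrev FinPinConfig : Type _ := {γ : FinConfig (PosReal × X) // γ.toConfig ∈ pinpointing X}

end Cone

section Maps

variable [TopologicalSpace X] [PolishSpace X] [LocallyCompactSpace X]

lemma Config.countable (γ : Config (PosReal × X)) : γ.carrier.Countable := by
  have : LocallyCompactSpace PosReal := (isOpen_Ioi (a := (0 : ℝ))).locallyCompactSpace
  have h : γ.carrier = ⋃ n, γ.carrier ∩ compactCovering (PosReal × X) n := by
    rw [← Set.inter_iUnion, iUnion_compactCovering, Set.inter_univ]
  rw [h]
  exact Set.countable_iUnion fun n =>
    (γ.finite_inter _ (isCompact_compactCovering _ n)).countable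

variable [BorelSpace X]

lemma weightedSum_apply (c : Set (PosReal × X)) {Λ : Set X} (hΛ : MeasurableSet Λ) :
    weightedSum c Λ =
      ∑' p : c, ENNReal.ofReal (p : PosReal × X).1 * Λ.indicator 1 (p : PosReal × X).2 := by
  rw [weightedSum, Measure.sum_apply _ hΛ]
  refine tsum_congr fun p => ?_
  rw [Measure.smul_apply, Measure.dirac_apply' _ hΛ, smul_eq_mul]

lemma localMass_eq (γ : Config (PosReal × X)) {Λ : Set X} (hΛ : MeasurableSet Λ) :
    localMass γ Λ = weightedSum γ.carrier Λ := by
  rw [weightedSum_apply _ hΛ, localMass, Config.toMeasure, lintegral_sum_measure]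
  refine tsum_congr fun p => ?_
  rw [lintegral_dirac']
  refine Measurable.mul ?_ ?_
  · exact ENNReal.measurable_ofReal.comp (measurable_subtype_coe.comp measurable_fst)
  · exact (measurable_one.indicator hΛ).comp measurable_snd

/-- The map `R : Π → K(X)`, `γ ↦ ∑_{(s,x) ∈ γ} s δ_x`. -/
noncomputable def toCone (γ : PinConfig X) : Cone X where
  toMeasure := weightedSum γ.1.carrier
  lt_top_of_isCompact C hC := by
    have h := γ.2.2 C ⟨hC.measurableSet, hC.closure⟩
    rwa [localMass_eq _ hC.measurableSet] at h
  discrete := ⟨γ.1.carrier, γ.1.countable,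
    fun p hp q hq h => Prod.ext (γ.2.1 p hp q hq h) h, rfl⟩

lemma supp_subset {η : Cone X} {c : Set (PosReal × X)} (h : η.toMeasure = weightedSum c) :
    η.supp ⊆ Prod.snd '' c := by
  intro x hx
  by_contra hc
  have h0 : η.toMeasure {x} = 0 := by
    rw [h, weightedSum_apply _ (measurableSet_singleton x), ENNReal.tsum_eq_zero]
    intro p
    have hp : (p : PosReal × X).2 ∉ ({x} : Set X) := fun hp => hc ⟨p.1, p.2, hp⟩
    rw [Set.indicator_of_notMem hp, mul_zero]
  simp [Cone.supp, Cone.weight, h0] at hx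

/-- The restriction of `R` to a map `Π₀ → K₀(X)`. -/
noncomputable def toFinCone (γ : FinPinConfig X) : FinCone X where
  toCone := RadonCone.toCone ⟨γ.1.toConfig, γ.2⟩
  finite := (γ.1.finite.image Prod.snd).subset (supp_subset rfl)

/-- The `σ`-algebra on `K₀(X)` transported from `Π₀` by the bijection `R`: a set is measurable
if and only if it is the image of a measurable set. -/
noncomputable instance : MeasurableSpace (FinCone X) :=
  MeasurableSpace.map toFinCone inferInstance

/-- The push-forward under `R` of a measure on configurations, restricted to `Π`. -/
noncomputable def conePushforward (P : Measure (Config (PosReal × X))) : Measure (Cone X) :=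
  (P.comap (Subtype.val : PinConfig X → Config (PosReal × X))).map toCone

lemma exists_weightedSum {n : ℕ} (y : Fin n → PosReal × X) :
    ∃ c : Set (PosReal × X), c.Finite ∧ Set.InjOn Prod.snd c ∧
      ∑ i, ENNReal.ofReal (y i).1 • Measure.dirac (y i).2 = weightedSum c := by
  classical
  let s : X → PosReal × X → ℝ := fun x p => if p.2 = x then (p.1 : ℝ) else 0
  have hs : ∀ j, 0 < ∑ i, s (y j).2 (y i) := fun j => by
    refine Finset.sum_pos' (fun i _ => ?_) ⟨j, Finset.mem_univ j, ?_⟩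
    · dsimp only [s]; split_ifs
      · exact (y i).1.2.le
      · exact le_rfl
    · simpa [s] using (y j).1.2
  let g : Fin n → PosReal × X := fun j => (⟨∑ i, s (y j).2 (y i), hs j⟩, (y j).2)
  have hg : ∀ i j, (y i).2 = (y j).2 → g i = g j := fun i j h => by
    refine Prod.ext (Subtype.ext ?_) h
    simp only [g, h]
  refine ⟨Set.range g, Set.finite_range g, ?_, ?_⟩
  · rintro _ ⟨i, rfl⟩ _ ⟨j, rfl⟩ h
    exact hg i j h
  · refine Measure.ext fun B hB => ?_
    rw [weightedSum_apply _ hB]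
    have hfin : Fintype (Set.range g) := (Set.finite_range g).fintype
    rw [tsum_fintype]
    simp only [Measure.coe_finsetSum, Finset.sum_apply, Measure.smul_apply, smul_eq_mul,
      Measure.dirac_apply' _ hB]
    rw [← Finset.sum_fiberwise_of_maps_to (s := Finset.univ) (t := Finset.univ)
      (g := fun i : Fin n => (⟨g i, i, rfl⟩ : Set.range g)) (fun _ _ => Finset.mem_univ _)]
    refine Finset.sum_congr rfl ?_
    rintro ⟨_, j, rfl⟩ -
    have hf : ∀ i, ((⟨g i, i, rfl⟩ : Set.range g) = ⟨g j, j, rfl⟩) ↔ (y i).2 = (y j).2 :=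
      fun i => by
        exact ⟨fun h => congrArg (fun p : Set.range g => (p : PosReal × X).2) h,
          fun h => Subtype.ext (hg i j h)⟩
    simp only [hf]
    have hw : ENNReal.ofReal ((g j).1 : ℝ) =
        ∑ i with (y i).2 = (y j).2, ENNReal.ofReal (y i).1 := by
      rw [← ENNReal.ofReal_sum_of_nonneg fun i _ => (y i).1.2.le, Finset.sum_filter]
    rw [hw, Finset.sum_mul]
    refine Finset.sum_congr rfl fun i hi => ?_
    rw [(Finset.mem_filter.1 hi).2]

/-- The measure `∑ᵢ sᵢ δ_{xᵢ} ∈ K₀(X)` given by a finite tuple `((s₁,x₁), …, (sₙ,xₙ))`. -/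
noncomputable def FinCone.ofTuple {n : ℕ} (y : Fin n → PosReal × X) : FinCone X where
  toCone :=
    { toMeasure := ∑ i, ENNReal.ofReal (y i).1 • Measure.dirac (y i).2
      lt_top_of_isCompact := fun C _ => by
        simp only [Measure.coe_finsetSum, Finset.sum_apply, Measure.smul_apply, smul_eq_mul]
        exact ENNReal.sum_lt_top.2 fun i _ => ENNReal.mul_lt_top ENNReal.ofReal_lt_top
          (measure_lt_top _ _)
      discrete := by
        obtain ⟨c, hc, hinj, h⟩ := exists_weightedSum y
        exact ⟨c, hc.countable, hinj, h⟩ }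
  finite := by
    obtain ⟨c, hc, -, h⟩ := exists_weightedSum y
    exact (hc.image Prod.snd).subset (supp_subset h)

/-- The Lebesgue-Poisson measure on `K₀(X)`, for which the integral of `G` is
`G(0) + ∑_{n ≥ 1} (1/n!) ∫ G(∑ᵢ sᵢ δ_{xᵢ}) dν(s₁)⋯dν(sₙ) dσ(x₁)⋯dσ(xₙ)`. -/
noncomputable def lebesguePoisson (ν : Measure PosReal) (σ : Measure X) : Measure (FinCone X) :=
  Measure.sum fun n : ℕ => ((n.factorial : ℝ≥0∞))⁻¹ •
    (Measure.pi fun _ : Fin n => ν.prod σ).map FinCone.ofTuple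

/-- Bounded measurable subsets of `K₀(X)`. -/
def IsBoundedSet (A : Set (FinCone X)) : Prop :=
  MeasurableSet A ∧ ∃ (a b : ℝ) (Λ : Set X) (N : ℕ), 0 < a ∧ a < b ∧ IsRelCompactBorel Λ ∧
    ∀ η ∈ A, η.toCone.supp ⊆ Λ ∧ η.toCone.supp.ncard ≤ N ∧
      ∀ x ∈ η.toCone.supp, η.toCone.weight x ∈ Set.Icc a b

/-- `ρ` is a measure on `K₀(X)` with `ρ(A) = ∫ K 1_A dμ` for every bounded set `A`, where the
integral exists and is finite. -/
def IsCorrelationMeasure (μ : Measure (Cone X)) (ρ : Measure (FinCone X)) : Prop :=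
  ∀ A : Set (FinCone X), IsBoundedSet A →
    Integrable (kTransform (A.indicator 1)) μ ∧
      ρ A = ENNReal.ofReal (∫ η, kTransform (A.indicator 1) η ∂μ)

end Maps

end RadonCone

/-!
Let `Y = (0, ∞) × X` and `m = ν ⊗ σ`. Everything rests on the factorial moment measures of the
Poisson configuration `γ`: the expectation of `∑ δ_(y₁, …, yₙ)` over the `n`-tuples of distinct
points of `γ` is the product measure `mⁿ` (`IsPoissonMeasure.bind_factorialMeasure`). On a product
`B₁ × ⋯ × Bₙ` of disjoint relatively compact sets this says `E ∏ γ(Bᵢ) = ∏ m(Bᵢ)`, which is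
independence together with the mean of the Poisson distribution. These products form a `π`-system,
countably many of them cover the tuples of distinct points (`exists_boxes`), and the other tuples
are `mⁿ`-null because `m` has no atoms.

This identity has three uses.

* The `k`-th power of `∑_{y ∈ γ} f(y)` is a sum over all `k`-tuples of points. Each of them is a
  `j`-tuple of distinct points, `j ≤ k`, with repetitions, so the expectation is bounded by finitely
  many products of integrals `∫ f^c dm` (`IsPoissonMeasure.lintegral_pow_lt_top`). With
  `f(s, x) = s 1_Λ(x)` these are the local moments.
* For `n = 2` it shows that almost surely no two points of `γ` have the same position in `X`,
  because `σ` has no atoms. With the finiteness of the local masses, `γ` is almost surely in the domain of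
  the map `R` (`IsPoissonMeasure.ae_mem_pinpointing`).
* `(K 1_A)(R γ)` counts the finite subsets of `γ` that represent an element of `A`. It is the sum
  over `n` of `1 / n!` times the number of `n`-tuples of distinct points that do so
  (`partCount_atoms`), and its expectation is the Lebesgue-Poisson measure of `A`.

The integrals over the cone are reduced to integrals over configurations by the inverse
`Cone.atoms` of `R`. Its measurability (`measurable_atoms`) holds because the number of points of
`R⁻¹ η` in `B` is `∫ s_x(η)⁻¹ 1_B(s_x(η), x) dη(x)`. That `R` and `R⁻¹` are measurable for the Borel
`σ`-algebras of the vague topologies follows from `exists_countable_vagueTopology`: on Radon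
measures, countably many integrals determine the vague topology.

The correlation measure is unique because `K₀(X)` is an increasing union of bounded sets
(`IsCorrelationMeasure.unique`).
-/

namespace RadonCone

open Filter Topology ProbabilityTheory

set_option linter.unusedSectionVars false

/-! ### Measurability and the vague topology -/

section Vague

variable {Y : Type*} [TopologicalSpace Y] [T2Space Y] [LocallyCompactSpace Y]
  [SecondCountableTopology Y] [MeasurableSpace Y] [BorelSpace Y]

/-- The mass of a compact set is the limit of the integrals of the powers of a compactly supported
function that takes the value `1` exactly on this set. -/
lemma measurable_measure_isCompact {Ω : Type*} [MeasurableSpace Ω] {M : Ω → Measure Y}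
    [∀ ω, IsFiniteMeasureOnCompacts (M ω)]
    (h : ∀ f : C_c(Y, ℝ), Measurable fun ω => ∫ y, f y ∂M ω) {K : Set Y} (hK : IsCompact K) :
    Measurable fun ω => M ω K := by
  let := TopologicalSpace.metrizableSpaceMetric Y
  obtain ⟨f, hfK, -, hf, hf01⟩ := exists_continuous_one_zero_of_isCompact_of_isGδ hK
    hK.isClosed.isGδ isClosed_empty (Set.disjoint_empty K)
  have hcs : ∀ n : ℕ, HasCompactSupport (f ^ (n + 1)) := fun n => by
    rw [pow_succ]; exact hf.mul_left
  have key : ∀ ω, Tendsto (fun n : ℕ => ∫ y, (f ^ (n + 1)) y ∂M ω) atTop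
      (𝓝 ((M ω).real K)) := by
    intro ω
    have h1 : (M ω).real K = ∫ y, K.indicator 1 y ∂M ω := by
      rw [integral_indicator_one hK.measurableSet]
    rw [h1]
    refine tendsto_integral_of_dominated_convergence (fun y => f y)
      (fun n => (f ^ (n + 1)).continuous.aestronglyMeasurable)
      (f.continuous.integrable_of_hasCompactSupport hf) (fun n => ?_) ?_
    · refine Eventually.of_forall fun y => ?_
      rw [ContinuousMap.pow_apply, Real.norm_of_nonneg (pow_nonneg (hf01 y).1 _)]
      exact pow_le_of_le_one (hf01 y).1 (hf01 y).2 (Nat.succ_ne_zero n)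
    · refine Eventually.of_forall fun y => ?_
      simp only [ContinuousMap.pow_apply]
      by_cases hy : y ∈ K
      · have : f y = 1 := by rw [hfK] at hy; exact hy
        simp [this, hy]
      · have hlt : f y < 1 := lt_of_le_of_ne (hf01 y).2 fun h => hy (by rw [hfK]; exact h)
        rw [Set.indicator_of_notMem hy]
        exact (tendsto_pow_atTop_nhds_zero_of_lt_one (hf01 y).1 hlt).comp (tendsto_add_atTop_nat 1)
  have hm : Measurable fun ω => (M ω).real K :=
    measurable_of_tendsto_metrizable (fun n => h ⟨f ^ (n + 1), hcs n⟩)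
      (tendsto_pi_nhds.2 key)
  convert hm.ennreal_ofReal with ω
  rw [ofReal_measureReal hK.measure_lt_top.ne]

/-- A family of Radon measures is measurable as soon as the integrals of compactly supported
continuous functions are. -/
lemma measurable_of_measurable_integral {Ω : Type*} [MeasurableSpace Ω] {M : Ω → Measure Y}
    [∀ ω, IsFiniteMeasureOnCompacts (M ω)]
    (h : ∀ f : C_c(Y, ℝ), Measurable fun ω => ∫ y, f y ∂M ω) : Measurable M := by
  let K := CompactExhaustion.choice Y
  have hK : ∀ n, Measurable fun ω => (M ω).restrict (K n) := fun n => by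
    have : ∀ ω, IsFiniteMeasure ((M ω).restrict (K n)) := fun ω =>
      ⟨by rw [Measure.restrict_apply_univ]; exact (K.isCompact n).measure_lt_top⟩
    have hmain : ∀ s : Set Y, IsClosed s → Measurable fun ω => (M ω).restrict (K n) s :=
      fun s hs => by
        simp_rw [Measure.restrict_apply hs.measurableSet]
        exact measurable_measure_isCompact h ((K.isCompact n).inter_left hs)
    exact Measurable.measure_of_isPiSystem (S := {s | IsClosed s})
      (by rw [← borel_eq_generateFrom_isClosed]; exact BorelSpace.measurable_eq)
      isPiSystem_isClosed hmain (hmain _ isClosed_univ)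
  refine Measure.measurable_of_measurable_coe _ fun s hs => ?_
  have : ∀ ω, M ω s = ⨆ n, (M ω).restrict (K n) s := fun ω => by
    simp_rw [Measure.restrict_apply hs]
    rw [← Directed.measure_iUnion, ← Set.inter_iUnion, K.iUnion_eq, Set.inter_univ]
    exact Monotone.directed_le fun i j hij => Set.inter_subset_inter_right s (K.subset hij)
  simp_rw [this]
  exact Measurable.iSup fun n => (Measure.measurable_coe hs).comp (hK n)

/-- Countably many compactly supported continuous functions determine the vague topology on a
family `ι` of Radon measures: every `f` vanishing outside a compact set `C` is uniformly
approximated by functions `φ g`, where `g` runs through a countable dense set of continuous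
functions and `φ` is a compactly supported function that is `1` on `C`. -/
lemma exists_countable_vagueTopology {T : Type*} (ι : T → Measure Y)
    [∀ t, IsFiniteMeasureOnCompacts (ι t)] :
    ∃ D : ℕ → C_c(Y, ℝ), (vagueTopology Y).induced ι =
      TopologicalSpace.induced (fun t n => ∫ y, D n y ∂ι t) inferInstance := by
  let K := CompactExhaustion.choice Y
  have hφ : ∀ n, ∃ φ : C(Y, ℝ), Set.EqOn φ 1 (K n) ∧ HasCompactSupport φ ∧
      ∀ x, φ x ∈ Set.Icc (0 : ℝ) 1 := fun n => by
    obtain ⟨φ, h1, -, h2, h3⟩ := exists_continuous_one_zero_of_isCompact (K.isCompact n)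
      isClosed_empty (Set.disjoint_empty _)
    exact ⟨φ, h1, h2, h3⟩
  choose φ hφ1 hφc hφ01 using hφ
  let g : ℕ → C(Y, ℝ) := TopologicalSpace.denseSeq C(Y, ℝ)
  -- The constant function `1` is included, to have the functions `φ n` themselves at hand.
  let g' : ℕ → C(Y, ℝ) := fun k => Nat.casesOn k 1 g
  let D' : ℕ × ℕ → C_c(Y, ℝ) := fun p => ⟨φ p.1 * g' p.2, (hφc p.1).mul_right⟩
  refine ⟨fun n => D' n.unpair, ?_⟩
  have hint : ∀ (f : C_c(Y, ℝ)) t, Integrable f (ι t) := fun f t =>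
    f.continuous.integrable_of_hasCompactSupport f.hasCompactSupport
  apply le_antisymm
  · let τ := (vagueTopology Y).induced ι
    rw [← continuous_iff_le_induced]
    refine continuous_pi fun n => ?_
    rw [continuous_iff_le_induced]
    refine (induced_mono (iInf_le _ (D' n.unpair))).trans ?_
    rw [induced_compose]
    rfl
  · let τ : TopologicalSpace T :=
      TopologicalSpace.induced (fun t n => ∫ y, D' (Nat.unpair n) y ∂ι t) inferInstance
    have hD : ∀ p, Continuous fun t => ∫ y, D' p y ∂ι t := fun p => by
      have := (continuous_apply (A := fun _ : ℕ => ℝ) (Nat.pair p.1 p.2)).comp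
        (continuous_induced_dom (f := fun t (n : ℕ) => ∫ y, D' n.unpair y ∂ι t))
      simpa [Function.comp_def] using this
    rw [vagueTopology, induced_iInf]
    refine le_iInf fun f => ?_
    rw [induced_compose, ← continuous_iff_le_induced]
    change Continuous fun t => ∫ y, f y ∂ι t
    obtain ⟨n, hn⟩ := K.exists_superset_of_isCompact f.hasCompactSupport.isCompact
    have hfn : ∀ y, f y = φ n y * f y := fun y => by
      by_cases hy : y ∈ K n
      · simp [hφ1 n hy]
      · simp [image_eq_zero_of_notMem_tsupport fun h => hy (hn h)]
    -- The integral of `φ n` is bounded near `t`, and `f` is approximated up to `ε (φ n)`.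
    refine continuous_of_locally_uniform_approx_of_continuousAt fun t u hu => ?_
    obtain ⟨ε, hε, hu⟩ := Metric.mem_uniformity_dist.1 hu
    have hone : ∀ y, D' (n, 0) y = φ n y := fun y => mul_one _
    set R := ∫ y, D' (n, 0) y ∂ι t
    have hR : 0 ≤ R := integral_nonneg fun y => by
      rw [hone]; exact (hφ01 n y).1
    have hR1 : 0 < R + 1 := by positivity
    obtain ⟨k, hk⟩ : ∃ k, ∀ y ∈ tsupport (φ n), dist (f y) (g k y) < ε / (R + 1) := by
      have hopen : {h : C(Y, ℝ) | ∀ y ∈ tsupport (φ n), dist (f y) (h y) < ε / (R + 1)} ∈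
          𝓝 (f : C(Y, ℝ)) := by
        have := (ContinuousMap.tendsto_iff_forall_isCompact_tendstoUniformlyOn.1
          (tendsto_id (x := 𝓝 (f : C(Y, ℝ))))) (tsupport (φ n)) (hφc n)
        exact (Metric.tendstoUniformlyOn_iff.1 this) _ (by positivity)
      obtain ⟨_, h, ⟨k, rfl⟩⟩ := mem_closure_iff_nhds.1
        (TopologicalSpace.denseRange_denseSeq C(Y, ℝ) (f : C(Y, ℝ))) _ hopen
      exact ⟨k, h⟩
    refine ⟨{s | ∫ y, D' (n, 0) y ∂ι s < R + 1},
      (isOpen_lt (hD _) continuous_const).mem_nhds (lt_add_one R),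
      fun s => ∫ y, D' (n, k + 1) y ∂ι s, (hD _).continuousAt, fun s hs => hu ?_⟩
    rw [Real.dist_eq, ← integral_sub (hint _ _) (hint _ _)]
    calc |∫ y, (f y - D' (n, k + 1) y) ∂ι s| ≤ ∫ y, ε / (R + 1) * D' (n, 0) y ∂ι s := by
          rw [← Real.norm_eq_abs]
          refine norm_integral_le_of_norm_le ((hint _ _).const_mul _)
            (Eventually.of_forall fun y => ?_)
          have h1 : f y - D' (n, k + 1) y = φ n y * (f y - g k y) := by
            rw [mul_sub, ← hfn]; rfl
          rw [h1, hone, norm_mul, Real.norm_of_nonneg (hφ01 n y).1, mul_comm]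
          by_cases hy : y ∈ tsupport (φ n)
          · gcongr
            · exact (hφ01 n y).1
            · rw [← dist_eq_norm]; exact (hk y hy).le
          · simp [image_eq_zero_of_notMem_tsupport hy]
      _ = ε / (R + 1) * ∫ y, D' (n, 0) y ∂ι s := integral_const_mul _ _
      _ < ε / (R + 1) * (R + 1) := by
          have : (∫ y, D' (n, 0) y ∂ι s) < R + 1 := hs
          gcongr
      _ = ε := div_mul_cancel₀ _ hR1.ne'

/-- Measurability into a space of Radon measures with the Borel `σ`-algebra of the vague topology
can be tested on integrals of compactly supported continuous functions. -/
lemma measurable_borel_vagueTopology {Ω T : Type*} [MeasurableSpace Ω] (ι : T → Measure Y)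
    [∀ t, IsFiniteMeasureOnCompacts (ι t)] {F : Ω → T}
    (h : ∀ f : C_c(Y, ℝ), Measurable fun ω => ∫ y, f y ∂ι (F ω)) :
    @Measurable _ _ _ (@borel T ((vagueTopology Y).induced ι)) F := by
  obtain ⟨D, hD⟩ := exists_countable_vagueTopology ι
  rw [hD, borel_comap, ← BorelSpace.measurable_eq, measurable_comap_iff]
  exact measurable_pi_lambda _ fun n => h (D n)

lemma measurable_integral_vagueTopology {T : Type*} (ι : T → Measure Y) (f : C_c(Y, ℝ)) :
    @Measurable _ _ (@borel T ((vagueTopology Y).induced ι)) _ fun t => ∫ y, f y ∂ι t := by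
  let := (vagueTopology Y).induced ι
  borelize T
  refine Continuous.measurable ?_
  rw [continuous_iff_le_induced]
  refine (induced_mono (iInf_le _ f)).trans ?_
  rw [induced_compose]
  rfl

lemma measurable_integral_of_measurable {Ω : Type*} [MeasurableSpace Ω] {M : Ω → Measure Y}
    [∀ ω, IsFiniteMeasureOnCompacts (M ω)] (hM : Measurable M) (f : C_c(Y, ℝ)) :
    Measurable fun ω => ∫ y, f y ∂M ω := by
  have hf : ∀ ω, Integrable f (M ω) := fun ω =>
    f.continuous.integrable_of_hasCompactSupport f.hasCompactSupport
  have hm : Measurable f := f.continuous.measurable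
  have (ω : Ω) := integral_eq_lintegral_pos_part_sub_lintegral_neg_part (hf ω)
  simp_rw [this]
  exact ((Measure.measurable_lintegral hm.ennreal_ofReal).comp hM).ennreal_toReal.sub
    ((Measure.measurable_lintegral hm.neg.ennreal_ofReal).comp hM).ennreal_toReal

end Vague

/-! ### Product measures and the Poisson distribution -/

section Product

lemma lintegral_pi_prod {Z : Type*} [MeasurableSpace Z] {n : ℕ} (μ : Fin n → Measure Z)
    [∀ i, SigmaFinite (μ i)] {f : Fin n → Z → ℝ≥0∞} (hf : ∀ i, Measurable (f i)) :
    ∫⁻ y, ∏ i, f i (y i) ∂Measure.pi μ = ∏ i, ∫⁻ z, f i z ∂μ i := by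
  induction n with
  | zero => simp
  | succ n ih =>
    have h := (measurePreserving_piFinSuccAbove μ 0).symm
    have hm : Measurable fun y : Fin (n + 1) → Z => ∏ i, f i (y i) :=
      Finset.measurable_prod _ fun i _ => (hf i).comp (measurable_pi_apply i)
    rw [← h.lintegral_comp hm]
    simp_rw [Fin.prod_univ_succ]
    have := lintegral_prod_mul (μ := μ 0) (ν := Measure.pi fun j : Fin n => μ j.succ)
      (f := f 0) (g := fun y => ∏ i, f i.succ (y i)) (hf 0).aemeasurable
      (Finset.measurable_prod _ fun i _ => (hf _).comp (measurable_pi_apply i)).aemeasurable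
    rw [ih _ fun i => hf i.succ] at this
    rw [← this]
    simp [MeasurableEquiv.piFinSuccAbove, Fin.insertNthEquiv]

/-- Two coordinates of a tuple almost never have the same image under a map with null fibres. -/
lemma ae_pi_injective {Y Z : Type*} [MeasurableSpace Y] [MeasurableSpace Z] [MeasurableEq Z]
    (m : Measure Y) [SigmaFinite m] {f : Y → Z} (hf : Measurable f) (h0 : ∀ z, m (f ⁻¹' {z}) = 0)
    (n : ℕ) : ∀ᵐ y ∂Measure.pi fun _ : Fin n => m, Function.Injective fun i => f (y i) := by
  have key : ∀ i j : Fin n, i ≠ j → ∀ᵐ y ∂Measure.pi fun _ : Fin n => m, f (y i) ≠ f (y j) := by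
    intro i j hij
    cases n with
    | zero => exact i.elim0
    | succ n =>
      obtain ⟨k, rfl⟩ := Fin.exists_succAbove_eq hij.symm
      have h := measurePreserving_piFinSuccAbove (fun _ : Fin (n + 1) => m) i
      have hs : MeasurableSet {p : Y × (Fin n → Y) | f p.1 = f (p.2 k)} :=
        measurableSet_eq_fun (hf.comp measurable_fst)
          (hf.comp ((measurable_pi_apply k).comp measurable_snd))
      have h2 : (m.prod (Measure.pi fun _ : Fin n => m)) {p | f p.1 = f (p.2 k)} = 0 := by
        rw [Measure.prod_apply_symm hs]
        refine (lintegral_congr fun y => ?_).trans lintegral_zero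
        exact h0 (f (y k))
      have h3 := h.measure_preimage hs.nullMeasurableSet
      rw [h2] at h3
      rw [ae_iff]
      simp only [ne_eq, not_not]
      exact h3
  have : ∀ᵐ y ∂Measure.pi fun _ : Fin n => m, ∀ i j, i ≠ j → f (y i) ≠ f (y j) := by
    simp_rw [ae_all_iff]
    exact key
  filter_upwards [this] with y hy i j hij
  by_contra hne
  exact hy i j hne hij

lemma measurableSet_injective_comp {Y Z : Type*} [MeasurableSpace Y] [MeasurableSpace Z]
    [MeasurableEq Z] {f : Y → Z} (hf : Measurable f) (n : ℕ) :
    MeasurableSet {y : Fin n → Y | Function.Injective fun i => f (y i)} := by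
  have : {y : Fin n → Y | Function.Injective fun i => f (y i)} =
      ⋂ (i) (j), {y | f (y i) = f (y j) → i = j} := by
    ext y; simp [Function.Injective]
  rw [this]
  refine MeasurableSet.iInter fun i => MeasurableSet.iInter fun j => ?_
  by_cases hij : i = j
  · simp [hij]
  · simp only [hij, imp_false]
    exact (measurableSet_eq_fun (hf.comp (measurable_pi_apply i))
      (hf.comp (measurable_pi_apply j))).compl

lemma lintegral_poissonMeasure (r : NNReal) :
    ∫⁻ k, (k : ℝ≥0∞) ∂ProbabilityTheory.poissonMeasure r = r := by
  rw [ProbabilityTheory.poissonMeasure, lintegral_sum_measure]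
  simp_rw [lintegral_smul_measure, lintegral_dirac, smul_eq_mul]
  rw [tsum_eq_zero_add' ENNReal.summable]
  have hterm : ∀ k : ℕ, ENNReal.ofReal (Real.exp (-r) * r ^ (k + 1) / (k + 1).factorial) *
      ((k + 1 : ℕ) : ℝ≥0∞) =
      r * ENNReal.ofReal (Real.exp (-r) * r ^ k / k.factorial) := fun k => by
    rw [← ENNReal.ofReal_natCast, ← ENNReal.ofReal_mul (by positivity),
      ← ENNReal.ofReal_coe_nnreal, ← ENNReal.ofReal_mul (by positivity)]
    congr 1
    rw [Nat.factorial_succ]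
    push_cast
    field_simp
    ring
  simp_rw [hterm, ENNReal.tsum_mul_left]
  rw [← ENNReal.ofReal_tsum_of_nonneg (fun k => by positivity)
    (ProbabilityTheory.hasSum_one_poissonMeasure r).summable,
    (ProbabilityTheory.hasSum_one_poissonMeasure r).tsum_eq]
  simp

end Product

/-! ### Factorial moment measures of configurations -/

section Config

variable {Y : Type*} [TopologicalSpace Y] [T2Space Y] [LocallyCompactSpace Y]
  [SecondCountableTopology Y] [MeasurableSpace Y] [BorelSpace Y]

lemma Config.carrier_countable (γ : Config Y) : γ.carrier.Countable := by
  rw [← Set.inter_univ γ.carrier, ← iUnion_compactCovering Y, Set.inter_iUnion]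
  exact Set.countable_iUnion fun n =>
    (γ.finite_inter _ (isCompact_compactCovering _ n)).countable

lemma Config.toMeasure_apply (γ : Config Y) {B : Set Y} (hB : MeasurableSet B) :
    γ.toMeasure B = (γ.carrier ∩ B).encard := by
  rw [Config.toMeasure, Measure.sum_apply _ hB, ← ENNReal.tsum_set_one]
  simp_rw [Measure.dirac_apply' _ hB]
  rw [tsum_subtype γ.carrier (B.indicator 1), Set.indicator_indicator]
  exact (tsum_subtype (γ.carrier ∩ B) (fun _ => (1 : ℝ≥0∞))).symm

lemma Config.finite_inter_isRelCompactBorel (γ : Config Y) {B : Set Y}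
    (hB : IsRelCompactBorel B) : (γ.carrier ∩ B).Finite :=
  (γ.finite_inter _ hB.2).subset (Set.inter_subset_inter_right _ subset_closure)

lemma Config.toMeasure_apply_isRelCompactBorel (γ : Config Y) {B : Set Y}
    (hB : IsRelCompactBorel B) : γ.toMeasure B = ((γ.carrier ∩ B).ncard : ℝ≥0∞) := by
  rw [γ.toMeasure_apply hB.1, ← (γ.finite_inter_isRelCompactBorel hB).cast_ncard_eq]
  rfl

lemma _root_.IsCompact.isRelCompactBorel {C : Set Y} (hC : IsCompact C) : IsRelCompactBorel C :=
  ⟨hC.measurableSet, hC.closure⟩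

lemma IsRelCompactBorel.inter {B B' : Set Y} (hB : IsRelCompactBorel B) (hB' : MeasurableSet B') :
    IsRelCompactBorel (B ∩ B') :=
  ⟨hB.1.inter hB', hB.2.of_isClosed_subset isClosed_closure (closure_mono Set.inter_subset_left)⟩

lemma IsRelCompactBorel.measure_lt_top {B : Set Y} (hB : IsRelCompactBorel B) (m : Measure Y)
    [IsFiniteMeasureOnCompacts m] : m B < ∞ :=
  (measure_mono subset_closure).trans_lt hB.2.measure_lt_top

instance (γ : Config Y) : IsFiniteMeasureOnCompacts γ.toMeasure :=
  ⟨fun C hC => by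
    rw [γ.toMeasure_apply_isRelCompactBorel hC.isRelCompactBorel]
    exact ENNReal.natCast_lt_top _⟩

lemma Config.ae_mem_carrier (γ : Config Y) : ∀ᵐ y ∂γ.toMeasure, y ∈ γ.carrier := by
  rw [ae_iff]
  have := γ.toMeasure_apply γ.carrier_countable.measurableSet.compl
  simp only [Set.inter_compl_self, Set.encard_empty, ENat.toENNReal_zero] at this
  exact this

lemma Config.toMeasure_singleton (γ : Config Y) {y : Y} (hy : y ∈ γ.carrier) :
    γ.toMeasure {y} = 1 := by
  rw [γ.toMeasure_apply (measurableSet_singleton y),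
    Set.inter_eq_right.2 (Set.singleton_subset_iff.2 hy)]
  simp

lemma measurable_config_toMeasure : Measurable (Config.toMeasure : Config Y → Measure Y) :=
  measurable_of_measurable_integral fun f => measurable_integral_vagueTopology _ f

/-- The measure `∑ δ_(y₁, …, yₙ)` over all `n`-tuples of distinct points of a configuration. -/
noncomputable def Config.factorialMeasure (γ : Config Y) (n : ℕ) : Measure (Fin n → Y) :=
  (Measure.pi fun _ => γ.toMeasure).restrict {y | Function.Injective y}

lemma Config.pi_toMeasure_apply (γ : Config Y) (n : ℕ) (S : Set (Fin n → Y)) :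
    (Measure.pi fun _ : Fin n => γ.toMeasure) S = {y ∈ S | ∀ i, y i ∈ γ.carrier}.encard := by
  have hae : ∀ᵐ y ∂Measure.pi fun _ : Fin n => γ.toMeasure, ∀ i, y i ∈ γ.carrier :=
    ae_all_iff.2 fun i => Measure.tendsto_eval_ae_ae.eventually γ.ae_mem_carrier
  have hc : {y ∈ S | ∀ i, y i ∈ γ.carrier}.Countable := by
    refine Set.Countable.mono ?_ (Set.countable_univ_pi fun _ : Fin n => γ.carrier_countable)
    exact fun y hy i _ => hy.2 i
  have h1 : (Measure.pi fun _ : Fin n => γ.toMeasure) S =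
      (Measure.pi fun _ : Fin n => γ.toMeasure) {y ∈ S | ∀ i, y i ∈ γ.carrier} := by
    refine measure_congr ?_
    filter_upwards [hae] with y hy
    exact propext ⟨fun h => ⟨h, hy⟩, fun h => h.1⟩
  rw [h1, ← ENNReal.tsum_set_one, ← Set.biUnion_of_singleton {y ∈ S | ∀ i, y i ∈ γ.carrier},
    measure_biUnion hc (fun a _ b _ hab => by simpa using hab)
      (fun y _ => measurableSet_singleton y)]
  rw [Set.biUnion_of_singleton]
  refine tsum_congr fun y => ?_
  rw [Measure.pi_singleton]
  exact Finset.prod_eq_one fun i _ => γ.toMeasure_singleton (y.2.2 i)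

lemma measurableSet_injective (n : ℕ) : MeasurableSet {y : Fin n → Y | Function.Injective y} :=
  measurableSet_injective_comp measurable_id n

lemma Config.factorialMeasure_apply (γ : Config Y) (n : ℕ) {S : Set (Fin n → Y)}
    (hS : MeasurableSet S) : γ.factorialMeasure n S =
      {y ∈ S | Function.Injective y ∧ ∀ i, y i ∈ γ.carrier}.encard := by
  rw [Config.factorialMeasure, Measure.restrict_apply hS,
    γ.pi_toMeasure_apply]
  simp only [Set.mem_inter_iff, Set.mem_ofPred_eq, and_assoc]

/-- The tuples of distinct points are covered by countably many products of disjoint sets. -/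
lemma exists_boxes (Y : Type*) [TopologicalSpace Y] [T2Space Y] [LocallyCompactSpace Y]
    [SecondCountableTopology Y] [MeasurableSpace Y] [BorelSpace Y] (n : ℕ) :
    ∃ B : ℕ → Fin n → Set Y, (∀ k i, IsRelCompactBorel (B k i)) ∧
      (∀ k, Pairwise fun i j => Disjoint (B k i) (B k j)) ∧
      {y : Fin n → Y | Function.Injective y} = ⋃ k, Set.univ.pi (B k) := by
  classical
  let K := CompactExhaustion.choice Y
  let b : Set (Set Y) := insert ∅ (TopologicalSpace.countableBasis Y)
  have hbc : Countable b := ((TopologicalSpace.countable_countableBasis Y).insert ∅).to_subtype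
  have : Nonempty b := ⟨⟨∅, Set.mem_insert _ _⟩⟩
  have hbo : ∀ u : b, IsOpen (u : Set Y) := by
    rintro ⟨u, rfl | hu⟩
    · exact isOpen_empty
    · exact TopologicalSpace.isOpen_of_mem_countableBasis hu
  let C : ℕ × (Fin n → b) → Fin n → Set Y := fun p i =>
    if Pairwise fun i j => Disjoint (p.2 i : Set Y) (p.2 j) then K p.1 ∩ p.2 i else ∅
  obtain ⟨e, he⟩ := exists_surjective_nat (ℕ × (Fin n → b))
  have hC : ∀ p, Pairwise fun i j => Disjoint (C p i) (C p j) := fun p i j hij => by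
    by_cases h : Pairwise fun i j => Disjoint (p.2 i : Set Y) (p.2 j)
    · simp only [C, if_pos h]
      exact (h hij).mono Set.inter_subset_right Set.inter_subset_right
    · simp only [C, if_neg h, Set.disjoint_empty]
  refine ⟨fun k => C (e k), fun k i => ?_, fun k => hC _, Set.Subset.antisymm ?_ ?_⟩
  · by_cases h : Pairwise fun i j => Disjoint ((e k).2 i : Set Y) ((e k).2 j)
    · simp only [C, if_pos h]
      exact (K.isCompact _).isRelCompactBorel.inter (hbo _).measurableSet
    · simp only [C, if_neg h]
      exact isCompact_empty.isRelCompactBorel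
  · intro y hy
    obtain ⟨U, hU, hd⟩ := (Set.finite_range y).t2_separation
    have h1 : ∀ i, ∃ u : b, y i ∈ (u : Set Y) ∧ (u : Set Y) ⊆ U (y i) := fun i => by
      obtain ⟨u, hu, hyu, huU⟩ :=
        (TopologicalSpace.isBasis_countableBasis Y).exists_subset_of_mem_open
          (hU (y i)).1 (hU (y i)).2
      exact ⟨⟨u, Set.mem_insert_of_mem _ hu⟩, hyu, huU⟩
    choose u hyu huU using h1
    obtain ⟨N, hN⟩ := K.exists_superset_of_isCompact (Set.finite_range y).isCompact
    obtain ⟨k, hk⟩ := he (N, u)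
    have hdis : Pairwise fun i j => Disjoint (u i : Set Y) (u j) := fun i j hij =>
      (hd ⟨i, rfl⟩ ⟨j, rfl⟩ fun h => hij (hy h)).mono (huU i) (huU j)
    refine Set.mem_iUnion.2 ⟨k, fun i _ => ?_⟩
    simp only [C, hk, if_pos hdis]
    exact ⟨hN ⟨i, rfl⟩, hyu i⟩
  · refine Set.iUnion_subset fun k y hy i j hij => ?_
    by_contra hne
    refine Set.disjoint_left.1 (hC (e k) hne) (hy i trivial) ?_
    have := hy j trivial
    rwa [← hij] at this

variable {P : Measure (Config Y)} {m : Measure Y} [IsFiniteMeasureOnCompacts m]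

/-- The expected product of the numbers of points in disjoint sets. -/
lemma IsPoissonMeasure.lintegral_prod (hP : IsPoissonMeasure m P) {n : ℕ} {B : Fin n → Set Y}
    (hB : ∀ i, IsRelCompactBorel (B i)) (hd : Pairwise fun i j => Disjoint (B i) (B j)) :
    ∫⁻ γ, ∏ i, γ.toMeasure (B i) ∂P = ∏ i, m (B i) := by
  have hm : ∀ i, Measurable fun γ : Config Y => γ.toMeasure (B i) := fun i =>
    (Measure.measurable_coe (hB i).1).comp measurable_config_toMeasure
  have hN : Measurable fun (γ : Config Y) (i : Fin n) => (γ.carrier ∩ B i).ncard := by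
    refine measurable_pi_lambda _ fun i => ?_
    convert ENNReal.measurable_toNNReal.comp (hm i) |>.coe_nnreal_real |> Nat.measurable_floor.comp
      with γ
    simp [γ.toMeasure_apply_isRelCompactBorel (hB i)]
  have h := hP.2 n B hB hd
  calc ∫⁻ γ, ∏ i, γ.toMeasure (B i) ∂P
      = ∫⁻ k : Fin n → ℕ, ∏ i, (k i : ℝ≥0∞) ∂P.map
          fun (γ : Config Y) (i : Fin n) => (γ.carrier ∩ B i).ncard := by
        rw [lintegral_map (measurable_of_countable _) hN]
        simp_rw [fun γ : Config Y => fun i => γ.toMeasure_apply_isRelCompactBorel (hB i)]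
    _ = ∏ i, m (B i) := by
        rw [h, lintegral_pi_prod _ fun _ => measurable_of_countable _]
        simp_rw [lintegral_poissonMeasure]
        exact Finset.prod_congr rfl fun i _ => ENNReal.coe_toNNReal ((hB i).measure_lt_top m).ne

lemma isFiniteMeasure_restrict_box (m : Measure Y) [IsFiniteMeasureOnCompacts m] {n : ℕ}
    {B : Fin n → Set Y} (hB : ∀ i, IsRelCompactBorel (B i)) :
    IsFiniteMeasure ((Measure.pi fun _ : Fin n => m).restrict (Set.univ.pi B)) :=
  ⟨by
    rw [Measure.restrict_apply_univ, Measure.pi_pi]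
    exact ENNReal.prod_lt_top fun i _ => (hB i).measure_lt_top m⟩

lemma restrict_box_apply (m : Measure Y) [IsFiniteMeasureOnCompacts m] {n : ℕ}
    (B : Fin n → Set Y) {A : Fin n → Set Y} (hA : ∀ i, MeasurableSet (A i)) :
    ((Measure.pi fun _ : Fin n => m).restrict (Set.univ.pi B)) (Set.univ.pi A) =
      ∏ i, m (B i ∩ A i) := by
  rw [Measure.restrict_apply (MeasurableSet.univ_pi hA), Set.pi_inter_distrib.symm,
    Measure.pi_pi]
  simp_rw [Set.inter_comm]

lemma measurable_restrict_box {n : ℕ} {B : Fin n → Set Y} (hB : ∀ i, IsRelCompactBorel (B i)) :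
    Measurable fun γ : Config Y =>
      (Measure.pi fun _ : Fin n => γ.toMeasure).restrict (Set.univ.pi B) := by
  have (γ : Config Y) := isFiniteMeasure_restrict_box γ.toMeasure hB
  have key : ∀ A : Fin n → Set Y, (∀ i, MeasurableSet (A i)) → Measurable fun γ : Config Y =>
      (Measure.pi fun _ : Fin n => γ.toMeasure).restrict (Set.univ.pi B) (Set.univ.pi A) := by
    intro A hA
    simp_rw [fun γ : Config Y => restrict_box_apply γ.toMeasure B hA]
    exact Finset.measurable_prod _ fun i _ =>
      (Measure.measurable_coe ((hB i).1.inter (hA i))).comp measurable_config_toMeasure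
  refine Measurable.measure_of_isPiSystem generateFrom_pi.symm isPiSystem_pi ?_ ?_
  · rintro _ ⟨A, hA, rfl⟩
    exact key A fun i => hA i trivial
  · simpa using key (fun _ => Set.univ) fun _ => MeasurableSet.univ

lemma IsPoissonMeasure.bind_restrict_box (hP : IsPoissonMeasure m P) {n : ℕ} {B : Fin n → Set Y}
    (hB : ∀ i, IsRelCompactBorel (B i)) (hd : Pairwise fun i j => Disjoint (B i) (B j)) :
    P.bind (fun γ => (Measure.pi fun _ : Fin n => γ.toMeasure).restrict (Set.univ.pi B)) =
      (Measure.pi fun _ : Fin n => m).restrict (Set.univ.pi B) := by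
  have key : ∀ A : Fin n → Set Y, (∀ i, MeasurableSet (A i)) →
      (Measure.pi fun _ : Fin n => m).restrict (Set.univ.pi B) (Set.univ.pi A) =
      P.bind (fun γ => (Measure.pi fun _ : Fin n => γ.toMeasure).restrict (Set.univ.pi B))
        (Set.univ.pi A) := by
    intro A hA
    rw [Measure.bind_apply (MeasurableSet.univ_pi hA) (measurable_restrict_box hB).aemeasurable,
      restrict_box_apply m B hA]
    simp_rw [fun γ : Config Y => restrict_box_apply γ.toMeasure B hA]
    exact (hP.lintegral_prod (fun i => (hB i).inter (hA i)) fun i j hij =>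
      (hd hij).mono Set.inter_subset_left Set.inter_subset_left).symm
  have := isFiniteMeasure_restrict_box m hB
  symm
  refine ext_of_generate_finite _ generateFrom_pi.symm isPiSystem_pi ?_ ?_
  · rintro _ ⟨A, hA, rfl⟩
    exact key A fun i => hA i trivial
  · simpa using key (fun _ => Set.univ) fun _ => MeasurableSet.univ

/-- On the tuples of distinct points, a power of a measure is the sum of its restrictions to
disjoint parts of the boxes `∏ᵢ Bₖᵢ`. -/
lemma restrict_injective_apply (m : Measure Y) [IsFiniteMeasureOnCompacts m] {n : ℕ}
    {B : ℕ → Fin n → Set Y} (hB : ∀ k i, IsRelCompactBorel (B k i))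
    (hu : {y : Fin n → Y | Function.Injective y} = ⋃ k, Set.univ.pi (B k)) {S : Set (Fin n → Y)}
    (hS : MeasurableSet S) :
    (Measure.pi fun _ : Fin n => m).restrict {y | Function.Injective y} S =
      ∑' k, (Measure.pi fun _ : Fin n => m).restrict (Set.univ.pi (B k))
        (S ∩ disjointed (fun k => Set.univ.pi (B k)) k) := by
  have hU : ∀ k, MeasurableSet (Set.univ.pi (B k)) := fun k =>
    MeasurableSet.univ_pi fun i => (hB k i).1
  have hD : ∀ k, MeasurableSet (disjointed (fun k => Set.univ.pi (B k)) k) :=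
    MeasurableSet.disjointed hU
  rw [hu, ← iUnion_disjointed, Measure.restrict_iUnion (disjoint_disjointed _) hD,
    Measure.sum_apply _ hS]
  refine tsum_congr fun k => ?_
  rw [Measure.restrict_apply hS, Measure.restrict_apply (hS.inter (hD k)), Set.inter_assoc,
    Set.inter_eq_left.2 (disjointed_le (fun k => Set.univ.pi (B k)) k)]

lemma measurable_factorialMeasure (n : ℕ) :
    Measurable fun γ : Config Y => γ.factorialMeasure n := by
  obtain ⟨B, hB, -, hu⟩ := exists_boxes Y n
  refine Measure.measurable_of_measurable_coe _ fun S hS => ?_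
  simp_rw [Config.factorialMeasure, fun γ : Config Y =>
    restrict_injective_apply γ.toMeasure hB hu hS]
  refine Measurable.tsum fun k => ?_
  exact (Measure.measurable_coe (hS.inter (MeasurableSet.disjointed (fun k =>
    MeasurableSet.univ_pi fun i => (hB k i).1) k))).comp (measurable_restrict_box (hB k))

/-- The factorial moment measures of a Poisson measure are the powers of its intensity. Both sides
agree on products of disjoint sets by independence, and these products determine a measure on the
tuples of distinct points. -/
theorem IsPoissonMeasure.bind_factorialMeasure [NullSingletonClass m] (hP : IsPoissonMeasure m P)
    (n : ℕ) : P.bind (fun γ => γ.factorialMeasure n) = Measure.pi fun _ : Fin n => m := by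
  obtain ⟨B, hB, hd, hu⟩ := exists_boxes Y n
  have h0 : (Measure.pi fun _ : Fin n => m).restrict {y | Function.Injective y} =
      Measure.pi fun _ : Fin n => m :=
    Measure.restrict_eq_self_of_ae_mem
      (ae_pi_injective m measurable_id (fun z => measure_singleton z) n)
  refine Measure.ext fun S hS => ?_
  have hS' : ∀ k, MeasurableSet (S ∩ disjointed (fun k => Set.univ.pi (B k)) k) := fun k =>
    hS.inter (MeasurableSet.disjointed (fun k => MeasurableSet.univ_pi fun i => (hB k i).1) k)
  rw [Measure.bind_apply hS (measurable_factorialMeasure n).aemeasurable, ← h0,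
    restrict_injective_apply m hB hu hS]
  simp_rw [Config.factorialMeasure, fun γ : Config Y =>
    restrict_injective_apply γ.toMeasure hB hu hS]
  have hm : ∀ k, Measurable fun γ : Config Y =>
      (Measure.pi fun _ : Fin n => γ.toMeasure).restrict (Set.univ.pi (B k))
        (S ∩ disjointed (fun k => Set.univ.pi (B k)) k) := fun k =>
    (Measure.measurable_coe (hS' k)).comp (measurable_restrict_box (hB k))
  rw [lintegral_tsum fun k => (hm k).aemeasurable]
  refine tsum_congr fun k => ?_
  rw [← hP.bind_restrict_box (hB k) (hd k),
    Measure.bind_apply (hS' k) (measurable_restrict_box (hB k)).aemeasurable]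

end Config

/-! ### Moments of linear functionals -/

section Moments

variable {Y : Type*} [TopologicalSpace Y] [T2Space Y] [LocallyCompactSpace Y]
  [SecondCountableTopology Y] [MeasurableSpace Y] [BorelSpace Y]

/-- Every tuple of points of a configuration arises from a tuple of distinct points by repetitions,
described by a surjection of the index sets. The tuple of distinct points is determined only up to
its order, whence an inequality. -/
lemma Config.pi_toMeasure_le (γ : Config Y) (k : ℕ) :
    (Measure.pi fun _ : Fin k => γ.toMeasure) ≤
      Measure.sum fun p : Σ j : Fin (k + 1), {π : Fin k → Fin j // Function.Surjective π} =>
        (γ.factorialMeasure p.1).map fun z i => z (p.2.1 i) := by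
  refine Measure.le_iff.2 fun S hS => ?_
  have hmeas : ∀ p : Σ j : Fin (k + 1), {π : Fin k → Fin j // Function.Surjective π},
      Measurable fun (z : Fin p.1 → Y) (i : Fin k) => z (p.2.1 i) := fun p =>
    measurable_pi_lambda _ fun i => measurable_pi_apply _
  let T : (Σ j : Fin (k + 1), {π : Fin k → Fin j // Function.Surjective π}) →
      Set (Fin k → Y) := fun p =>
    (fun (z : Fin p.1 → Y) i => z (p.2.1 i)) ''
      {z | (fun i => z (p.2.1 i)) ∈ S ∧ Function.Injective z ∧ ∀ i, z i ∈ γ.carrier}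
  have hcover : {y ∈ S | ∀ i, y i ∈ γ.carrier} ⊆ ⋃ p, T p := by
    classical
    rintro y ⟨hyS, hy⟩
    have hcard : Fintype.card (Set.range y) < k + 1 :=
      Nat.lt_succ_of_le ((Fintype.card_range_le y).trans_eq (Fintype.card_fin k))
    let e := Fintype.equivFin (Set.range y)
    have hfac : (fun i => ((e.symm (e ⟨y i, i, rfl⟩) : Set.range y) : Y)) = y := by
      ext i; simp
    refine Set.mem_iUnion.2 ⟨⟨⟨_, hcard⟩, fun i => e ⟨y i, i, rfl⟩, ?_⟩,
      fun l => (e.symm l : Set.range y), ⟨?_, ?_, ?_⟩, hfac⟩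
    · intro l
      obtain ⟨i, hi⟩ := (e.symm l).2
      refine ⟨i, ?_⟩
      have : (⟨y i, i, rfl⟩ : Set.range y) = e.symm l := Subtype.ext hi
      simp only [this, e.apply_symm_apply]
    · change (fun i => ((e.symm (e ⟨y i, i, rfl⟩) : Set.range y) : Y)) ∈ S
      rwa [hfac]
    · exact Subtype.val_injective.comp e.symm.injective
    · intro l
      obtain ⟨i, hi⟩ := (e.symm l).2
      have h := hy i
      rw [hi] at h
      exact h
  have h1 : (Measure.pi fun _ : Fin k => γ.toMeasure) S ≤
      (Measure.pi fun _ : Fin k => γ.toMeasure) (⋃ p, T p) := by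
    rw [γ.pi_toMeasure_apply, γ.pi_toMeasure_apply]
    exact ENat.toENNReal_mono (Set.encard_le_encard fun y hy => ⟨hcover hy, hy.2⟩)
  refine h1.trans ((measure_iUnion_le _).trans ?_)
  rw [Measure.sum_apply _ hS]
  refine ENNReal.tsum_le_tsum fun p => ?_
  rw [Measure.map_apply (hmeas p) hS, γ.factorialMeasure_apply _ (hmeas p hS),
    γ.pi_toMeasure_apply]
  exact ENat.toENNReal_mono
    ((Set.encard_le_encard fun y hy => hy.1).trans (Set.encard_image_le _ _))

/-- A linear functional of a Poisson configuration has moments of all orders if the powers of the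
integrand are integrable with respect to the intensity. -/
lemma IsPoissonMeasure.lintegral_pow_lt_top {P : Measure (Config Y)} {m : Measure Y}
    [IsFiniteMeasureOnCompacts m] [NullSingletonClass m] (hP : IsPoissonMeasure m P)
    {f : Y → ℝ≥0∞} (hf : Measurable f) (hfin : ∀ n : ℕ, 1 ≤ n → ∫⁻ y, f y ^ n ∂m < ∞) (k : ℕ) :
    ∫⁻ γ, (∫⁻ y, f y ∂γ.toMeasure) ^ k ∂P < ∞ := by
  let I := Σ j : Fin (k + 1), {π : Fin k → Fin j // Function.Surjective π}
  have hF : Measurable fun y : Fin k → Y => ∏ i, f (y i) :=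
    Finset.measurable_prod _ fun i _ => hf.comp (measurable_pi_apply i)
  have hmeas : ∀ p : I, Measurable fun (z : Fin p.1 → Y) (i : Fin k) => z (p.2.1 i) := fun p =>
    measurable_pi_lambda _ fun i => measurable_pi_apply _
  have hle : ∀ γ : Config Y, (∫⁻ y, f y ∂γ.toMeasure) ^ k ≤
      ∑ p : I, ∫⁻ z, ∏ i, f (z (p.2.1 i)) ∂γ.factorialMeasure p.1 := fun γ => by
    have h := lintegral_pi_prod (fun _ : Fin k => γ.toMeasure) fun _ => hf
    rw [Finset.prod_const, Finset.card_univ, Fintype.card_fin] at h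
    rw [← h]
    refine (lintegral_mono' (γ.pi_toMeasure_le k) le_rfl).trans_eq ?_
    rw [lintegral_sum_measure, tsum_fintype]
    exact Finset.sum_congr rfl fun p _ => lintegral_map hF (hmeas p)
  refine (lintegral_mono hle).trans_lt ?_
  have hm : ∀ p : I, Measurable fun γ : Config Y =>
      ∫⁻ z, ∏ i, f (z (p.2.1 i)) ∂γ.factorialMeasure p.1 := fun p =>
    (Measure.measurable_lintegral (hF.comp (hmeas p))).comp (measurable_factorialMeasure _)
  rw [lintegral_finsetSum _ fun p _ => hm p]
  refine ENNReal.sum_lt_top.2 fun p _ => ?_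
  have h2 : ∫⁻ γ, ∫⁻ z, ∏ i, f (z (p.2.1 i)) ∂γ.factorialMeasure p.1 ∂P =
      ∫⁻ z, ∏ i, f (z (p.2.1 i)) ∂Measure.pi fun _ : Fin p.1 => m := by
    rw [← hP.bind_factorialMeasure]
    exact (Measure.lintegral_bind (measurable_factorialMeasure _).aemeasurable
      (hF.comp (hmeas p)).aemeasurable).symm
  rw [h2]
  classical
  have h3 : ∀ z : Fin p.1 → Y, ∏ i, f (z (p.2.1 i)) =
      ∏ l, f (z l) ^ (Finset.univ.filter fun i => p.2.1 i = l).card := fun z => by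
    rw [← Finset.prod_fiberwise_of_maps_to (s := Finset.univ) (t := Finset.univ) (g := p.2.1)
      fun _ _ => Finset.mem_univ _]
    refine Finset.prod_congr rfl fun l _ => ?_
    rw [← Finset.prod_const]
    exact Finset.prod_congr rfl fun i hi => by rw [(Finset.mem_filter.1 hi).2]
  simp_rw [h3]
  rw [lintegral_pi_prod (fun _ : Fin p.1 => m) fun l => hf.pow_const _]
  refine ENNReal.prod_lt_top fun l _ => hfin _ ?_
  obtain ⟨i, hi⟩ := p.2.2 l
  exact Finset.card_pos.2 ⟨i, by simp [hi]⟩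

end Moments

/-! ### Pinpointing configurations -/

section Pinpointing

instance : LocallyCompactSpace PosReal := (isOpen_Ioi (a := (0 : ℝ))).locallyCompactSpace

variable {X : Type*} [TopologicalSpace X] [PolishSpace X] [LocallyCompactSpace X]
  [MeasurableSpace X] [BorelSpace X]

lemma measurable_localMass_integrand {Λ : Set X} (hΛ : MeasurableSet Λ) :
    Measurable fun p : PosReal × X => ENNReal.ofReal p.1 * Λ.indicator 1 p.2 :=
  (ENNReal.measurable_ofReal.comp (measurable_subtype_coe.comp measurable_fst)).mul
    ((measurable_one.indicator hΛ).comp measurable_snd)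

lemma measurable_localMass {Λ : Set X} (hΛ : MeasurableSet Λ) :
    Measurable fun γ : Config (PosReal × X) => localMass γ Λ :=
  (Measure.measurable_lintegral (measurable_localMass_integrand hΛ)).comp
    measurable_config_toMeasure

lemma prod_preimage_snd_singleton (ν : Measure PosReal) [IsFiniteMeasureOnCompacts ν]
    (σ : Measure X) [IsFiniteMeasureOnCompacts σ] [NullSingletonClass σ] (x : X) :
    (ν.prod σ) (Prod.snd ⁻¹' {x} : Set (PosReal × X)) = 0 := by
  rw [← Set.univ_prod, Measure.prod_prod, measure_singleton, mul_zero]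

variable {ν : Measure PosReal} [IsFiniteMeasureOnCompacts ν] [NullSingletonClass ν]
    {σ : Measure X} [IsFiniteMeasureOnCompacts σ] [NullSingletonClass σ]
    {P : Measure (Config (PosReal × X))}

lemma IsPoissonMeasure.lintegral_localMass_pow_lt_top (hP : IsPoissonMeasure (ν.prod σ) P)
    (hν : ∀ n : ℕ, 1 ≤ n → ∫⁻ s, ENNReal.ofReal ((s : ℝ) ^ n) ∂ν < ∞) {Λ : Set X}
    (hΛ : IsRelCompactBorel Λ) (k : ℕ) : ∫⁻ γ, localMass γ Λ ^ k ∂P < ∞ := by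
  refine hP.lintegral_pow_lt_top (measurable_localMass_integrand hΛ.1) (fun n hn => ?_) k
  have h : ∀ p : PosReal × X, (ENNReal.ofReal p.1 * Λ.indicator 1 p.2) ^ n =
      ENNReal.ofReal ((p.1 : ℝ) ^ n) * Λ.indicator 1 p.2 := fun p => by
    rw [mul_pow, ENNReal.ofReal_pow p.1.2.le]
    congr 1
    by_cases hp : p.2 ∈ Λ
    · simp [hp]
    · simp [hp, Nat.one_le_iff_ne_zero.1 hn]
  simp_rw [h]
  have hm : Measurable fun s : PosReal => ENNReal.ofReal ((s : ℝ) ^ n) :=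
    ENNReal.measurable_ofReal.comp (measurable_subtype_coe.pow_const n)
  rw [lintegral_prod_mul (f := fun s : PosReal => ENNReal.ofReal ((s : ℝ) ^ n))
    (g := Λ.indicator 1) hm.aemeasurable (measurable_one.indicator hΛ.1).aemeasurable,
    lintegral_indicator_one hΛ.1]
  exact ENNReal.mul_lt_top (hν n hn) (hΛ.measure_lt_top σ)

/-- Almost surely, no two points of a Poisson configuration have the same position in `X`, because
the second factorial moment measure vanishes on such pairs, and all local masses have finite
expectation. -/
lemma IsPoissonMeasure.ae_mem_pinpointing (hP : IsPoissonMeasure (ν.prod σ) P)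
    (hν : ∀ n : ℕ, 1 ≤ n → ∫⁻ s, ENNReal.ofReal ((s : ℝ) ^ n) ∂ν < ∞) :
    ∀ᵐ γ ∂P, γ ∈ pinpointing X := by
  have hinj := measurableSet_injective_comp (Y := PosReal × X) measurable_snd 2
  have h1 : ∀ᵐ γ ∂P, γ.factorialMeasure 2
      {y : Fin 2 → PosReal × X | Function.Injective fun i => (y i).2}ᶜ = 0 := by
    have hm : Measurable fun γ : Config (PosReal × X) => γ.factorialMeasure 2
        {y : Fin 2 → PosReal × X | Function.Injective fun i => (y i).2}ᶜ :=
      (Measure.measurable_coe hinj.compl).comp (measurable_factorialMeasure 2)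
    refine (lintegral_eq_zero_iff hm).1 ?_
    rw [← Measure.bind_apply hinj.compl (measurable_factorialMeasure 2).aemeasurable,
      hP.bind_factorialMeasure]
    exact ae_pi_injective (ν.prod σ) measurable_snd (prod_preimage_snd_singleton ν σ) 2
  let K := CompactExhaustion.choice X
  have h2 : ∀ᵐ γ ∂P, ∀ n, localMass γ (K n) < ∞ := by
    refine ae_all_iff.2 fun n => ?_
    have h := hP.lintegral_localMass_pow_lt_top hν (K.isCompact n).isRelCompactBorel 1
    simp_rw [pow_one] at h
    exact ae_lt_top (measurable_localMass (K.isCompact n).measurableSet) h.ne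
  filter_upwards [h1, h2] with γ hγ1 hγ2
  refine ⟨fun p hp q hq hpq => ?_, fun Λ hΛ => ?_⟩
  · by_contra hne
    rw [γ.factorialMeasure_apply 2 hinj.compl, ENat.toENNReal_eq_zero, Set.encard_eq_zero] at hγ1
    refine Set.eq_empty_iff_forall_notMem.1 hγ1 ![p, q] ⟨fun h => ?_, ?_, ?_⟩
    · exact absurd (@h 0 1 hpq) (by decide)
    · intro i j hij
      fin_cases i <;> fin_cases j <;> simp_all
    · intro i
      fin_cases i <;> simp [hp, hq]
  · obtain ⟨n, hn⟩ := K.exists_superset_of_isCompact hΛ.2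
    refine (lintegral_mono fun p => ?_).trans_lt (hγ2 n)
    dsimp only
    gcongr
    exact subset_closure.trans hn

end Pinpointing

/-! ### Kernels of Radon measures -/

section Kernel

/-- A kernel of Radon measures is s-finite: on a relatively compact piece it is finite, and
uniformly so on the set of parameters where the mass of the piece lies between two consecutive integers. -/
lemma isSFiniteKernel_of_isFiniteMeasureOnCompacts {Ω Y : Type*} [MeasurableSpace Ω]
    [TopologicalSpace Y] [T2Space Y] [LocallyCompactSpace Y] [SecondCountableTopology Y]
    [MeasurableSpace Y] [BorelSpace Y] (κ : Kernel Ω Y) [∀ ω, IsFiniteMeasureOnCompacts (κ ω)] :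
    IsSFiniteKernel κ := by
  classical
  let K := CompactExhaustion.choice Y
  have hD : ∀ n, MeasurableSet (disjointed K n) :=
    MeasurableSet.disjointed fun n => (K.isCompact n).measurableSet
  have hfin : ∀ n ω, κ ω (disjointed K n) < ∞ := fun n ω =>
    (measure_mono (disjointed_le K n)).trans_lt (K.isCompact n).measure_lt_top
  let A : ℕ → ℕ → Set Ω := fun n k => {ω | ⌊(κ ω (disjointed K n)).toReal⌋₊ = k}
  have hA : ∀ n k, MeasurableSet (A n k) := fun n k =>
    (Nat.measurable_floor.comp (κ.measurable_coe (hD n)).ennreal_toReal) (measurableSet_singleton k)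
  let κ' : ℕ × ℕ → Kernel Ω Y := fun p => Kernel.piecewise (hA p.1 p.2) (κ.restrict (hD p.1)) 0
  have hκ' : ∀ p, IsFiniteKernel (κ' p) := fun p => by
    refine ⟨(p.2 : ℝ≥0∞) + 1, by finiteness, fun ω => ?_⟩
    by_cases hω : ω ∈ A p.1 p.2
    · simp only [κ', Kernel.piecewise_apply, if_pos hω, Kernel.restrict_apply,
        Measure.restrict_apply_univ]
      rw [← ENNReal.ofReal_toReal (hfin p.1 ω).ne]
      have h1 : (κ ω (disjointed K p.1)).toReal ≤ p.2 + 1 := by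
        have : ⌊(κ ω (disjointed K p.1)).toReal⌋₊ = p.2 := hω
        rw [← this]
        exact (Nat.lt_floor_add_one _).le
      refine (ENNReal.ofReal_le_ofReal h1).trans_eq ?_
      rw [ENNReal.ofReal_add (by positivity) zero_le_one, ENNReal.ofReal_natCast,
        ENNReal.ofReal_one]
    · simp [κ', Kernel.piecewise_apply, if_neg hω]
  have hsum : κ = Kernel.sum κ' := by
    refine Kernel.ext fun ω => Measure.ext fun S hS => ?_
    rw [Kernel.sum_apply, Measure.sum_apply _ hS, ENNReal.tsum_prod']
    have h1 : ∀ n, ∑' k, κ' (n, k) ω S = (κ ω).restrict (disjointed K n) S := fun n => by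
      rw [tsum_eq_single ⌊(κ ω (disjointed K n)).toReal⌋₊]
      · have : ω ∈ A n ⌊(κ ω (disjointed K n)).toReal⌋₊ := rfl
        simp only [κ', Kernel.piecewise_apply, if_pos this, Kernel.restrict_apply]
      · intro k hk
        have : ω ∉ A n k := fun h => hk h.symm
        simp only [κ', Kernel.piecewise_apply, if_neg this, zero_apply,
          Measure.coe_zero, Pi.zero_apply]
    simp_rw [h1]
    rw [← Measure.sum_apply _ hS, ← Measure.restrict_iUnion (disjoint_disjointed _) hD,
      iUnion_disjointed, K.iUnion_eq, Measure.restrict_univ]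
  rw [hsum]
  exact Kernel.isSFiniteKernel_sum

end Kernel

/-! ### The inverse of the map from configurations to the cone -/

section Atoms

variable {X : Type*} [TopologicalSpace X] [PolishSpace X] [LocallyCompactSpace X]
  [MeasurableSpace X] [BorelSpace X]

lemma weightedSum_singleton {c : Set (PosReal × X)} (hc : Set.InjOn Prod.snd c)
    {p : PosReal × X} (hp : p ∈ c) : weightedSum c {p.2} = ENNReal.ofReal p.1 := by
  rw [weightedSum_apply _ (measurableSet_singleton _), tsum_eq_single ⟨p, hp⟩]
  · simp
  · rintro ⟨q, hq⟩ hne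
    have : q.2 ∉ ({p.2} : Set X) := fun h => hne (Subtype.ext (hc hq hp h))
    simp [Set.indicator_of_notMem this]

lemma weightedSum_singleton_eq_iff {c : Set (PosReal × X)} (hc : Set.InjOn Prod.snd c)
    {p : PosReal × X} : weightedSum c {p.2} = ENNReal.ofReal p.1 ↔ p ∈ c := by
  refine ⟨fun h => ?_, weightedSum_singleton hc⟩
  by_cases hx : ∃ q ∈ c, q.2 = p.2
  · obtain ⟨q, hq, hqp⟩ := hx
    rw [← hqp, weightedSum_singleton hc hq,
      ENNReal.ofReal_eq_ofReal_iff q.1.2.le p.1.2.le] at h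
    rwa [← Prod.ext (Subtype.ext h) hqp]
  · exfalso
    have h0 : weightedSum c {p.2} = 0 := by
      rw [weightedSum_apply _ (measurableSet_singleton _), ENNReal.tsum_eq_zero]
      rintro ⟨q, hq⟩
      have : q.2 ∉ ({p.2} : Set X) := fun h => hx ⟨q, hq, h⟩
      simp [Set.indicator_of_notMem this]
    rw [h0] at h
    exact (ENNReal.ofReal_pos.2 p.1.2).ne h

/-- The pairs `(s_x(η), x)`, `x ∈ τ(η)`. -/
def Cone.points (η : Cone X) : Set (PosReal × X) :=
  {p | η.toMeasure {p.2} = ENNReal.ofReal p.1}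

lemma Cone.points_eq {η : Cone X} {c : Set (PosReal × X)} (hc : Set.InjOn Prod.snd c)
    (h : η.toMeasure = weightedSum c) : η.points = c := by
  ext p
  rw [← weightedSum_singleton_eq_iff hc, ← h]
  rfl

lemma Cone.toMeasure_eq (η : Cone X) : η.toMeasure = weightedSum η.points := by
  obtain ⟨c, -, hc, h⟩ := η.discrete
  rw [Cone.points_eq hc h, h]

lemma Cone.injOn_points (η : Cone X) : Set.InjOn Prod.snd η.points := by
  obtain ⟨c, -, hc, h⟩ := η.discrete
  rwa [Cone.points_eq hc h]

instance (η : Cone X) : IsFiniteMeasureOnCompacts η.toMeasure :=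
  ⟨fun _ hC => η.lt_top_of_isCompact _ hC⟩

/-- The configuration `R⁻¹ η = {(s_x(η), x) : x ∈ τ(η)}`. -/
def Cone.atoms (η : Cone X) : Config (PosReal × X) where
  carrier := η.points
  finite_inter C hC := by
    -- On `C` the weights are bounded below by some `a > 0`, and the total mass is finite.
    rcases C.eq_empty_or_nonempty with rfl | hne
    · simp
    obtain ⟨p₀, -, hp₀⟩ := hC.exists_isMinOn hne continuous_fst.continuousOn
    have hK : IsCompact (Prod.snd '' C) := hC.image continuous_snd
    have hfin : ∑' p : η.points, ENNReal.ofReal (p : PosReal × X).1 *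
        (Prod.snd '' C).indicator 1 (p : PosReal × X).2 ≠ ∞ := by
      rw [← weightedSum_apply _ hK.measurableSet, ← η.toMeasure_eq]
      exact hK.measure_lt_top.ne
    have h := ENNReal.finite_const_le_of_tsum_ne_top hfin
      (ENNReal.ofReal_pos.2 p₀.1.2).ne'
    refine (h.image Subtype.val).subset ?_
    rintro p ⟨hp, hpC⟩
    refine ⟨⟨p, hp⟩, ?_, rfl⟩
    have hmem : p.2 ∈ Prod.snd '' C := ⟨p, hpC, rfl⟩
    simp only [Set.mem_ofPred_eq, Set.indicator_of_mem hmem, Pi.one_apply, mul_one]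
    exact ENNReal.ofReal_le_ofReal (hp₀ hpC)

lemma atoms_toCone (γ : PinConfig X) : (toCone γ).atoms = γ.1 :=
  Config.ext (Cone.points_eq (fun p hp q hq h => Prod.ext (γ.2.1 p hp q hq h) h) rfl)

lemma localMass_atoms (η : Cone X) {Λ : Set X} (hΛ : MeasurableSet Λ) :
    localMass η.atoms Λ = η.toMeasure Λ := by
  rw [localMass_eq _ hΛ, η.toMeasure_eq]
  rfl

lemma measurable_cone_toMeasure : Measurable (Cone.toMeasure : Cone X → Measure X) :=
  measurable_of_measurable_integral fun f => measurable_integral_vagueTopology _ f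

lemma measurable_toCone : Measurable (toCone : PinConfig X → Cone X) := by
  refine measurable_borel_vagueTopology Cone.toMeasure fun f => ?_
  refine measurable_integral_of_measurable (M := fun γ : PinConfig X => (toCone γ).toMeasure) ?_ f
  refine Measure.measurable_of_measurable_coe _ fun Λ hΛ => ?_
  have : ∀ γ : PinConfig X, (toCone γ).toMeasure Λ = localMass γ.1 Λ := fun γ =>
    (localMass_eq _ hΛ).symm
  simp_rw [this]
  exact (measurable_localMass hΛ).comp measurable_subtype_coe

/-- The conversion of masses into positive numbers, with the value `1` for the masses `0` and `∞`,
which are not masses of atoms. -/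
noncomputable def toPosReal (r : ℝ≥0∞) : PosReal :=
  ⟨if 0 < r.toReal then r.toReal else 1, by split_ifs with h; exacts [h, one_pos]⟩

lemma measurable_toPosReal : Measurable toPosReal :=
  (Measurable.ite (measurableSet_lt measurable_const ENNReal.measurable_toReal)
    ENNReal.measurable_toReal measurable_const).subtype_mk

lemma toPosReal_ofReal (s : PosReal) : toPosReal (ENNReal.ofReal s) = s := by
  refine Subtype.ext ?_
  simp [toPosReal, ENNReal.toReal_ofReal s.2.le, s.2]

/-- The inverse of `R` is measurable. The number of points of `R⁻¹ η` in a set `B` is the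
`η`-integral of `s_x(η)⁻¹ 1_B(s_x(η), x)`, and `s_x(η)` is jointly measurable in `η` and `x`. -/
lemma measurable_atoms : Measurable (Cone.atoms : Cone X → Config (PosReal × X)) := by
  let κ : Kernel (Cone X) X := ⟨Cone.toMeasure, measurable_cone_toMeasure⟩
  have hκc : ∀ η, IsFiniteMeasureOnCompacts (κ η) := fun η =>
    inferInstanceAs (IsFiniteMeasureOnCompacts η.toMeasure)
  have hκ : IsSFiniteKernel κ := isSFiniteKernel_of_isFiniteMeasureOnCompacts κ
  have hw : Measurable fun q : Cone X × X => q.1.toMeasure {q.2} := by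
    have hdiag : MeasurableSet {r : (Cone X × X) × X | r.2 = r.1.2} :=
      measurableSet_eq_fun measurable_snd (measurable_snd.comp measurable_fst)
    exact Kernel.measurable_kernel_prodMk_left
      (κ := κ.comap (Prod.fst : Cone X × X → Cone X) measurable_fst) hdiag
  refine measurable_borel_vagueTopology Config.toMeasure fun f => ?_
  refine measurable_integral_of_measurable (M := fun η : Cone X => η.atoms.toMeasure) ?_ f
  refine Measure.measurable_of_measurable_coe _ fun B hB => ?_
  have hg : Measurable fun q : Cone X × X => (q.1.toMeasure {q.2})⁻¹ *
      B.indicator (1 : PosReal × X → ℝ≥0∞) (toPosReal (q.1.toMeasure {q.2}), q.2) :=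
    hw.inv.mul ((measurable_one.indicator hB).comp
      ((measurable_toPosReal.comp hw).prodMk measurable_snd))
  convert hg.lintegral_kernel_prod_right' (κ := κ) using 2 with η
  change _ = ∫⁻ x, (η.toMeasure {x})⁻¹ *
    B.indicator (1 : PosReal × X → ℝ≥0∞) (toPosReal (η.toMeasure {x}), x) ∂η.toMeasure
  conv_rhs => rw [η.toMeasure_eq]
  rw [weightedSum, lintegral_sum_measure, Config.toMeasure, Measure.sum_apply _ hB]
  refine tsum_congr fun p => ?_
  have hp : weightedSum η.points {(p : PosReal × X).2} = ENNReal.ofReal (p : PosReal × X).1 :=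
    weightedSum_singleton η.injOn_points p.2
  have hpos : ENNReal.ofReal (p : PosReal × X).1 ≠ 0 :=
    (ENNReal.ofReal_pos.2 (p : PosReal × X).1.2).ne'
  rw [lintegral_smul_measure, lintegral_dirac, Measure.dirac_apply' _ hB, ← weightedSum, hp,
    toPosReal_ofReal, smul_eq_mul, ← mul_assoc, ENNReal.mul_inv_cancel hpos ENNReal.ofReal_ne_top,
    one_mul]

/-- The push-forward of a measure on configurations under `R` is mapped back by `R⁻¹`. -/
lemma map_atoms_conePushforward {P : Measure (Config (PosReal × X))}
    (hP : ∀ᵐ γ ∂P, γ ∈ pinpointing X) : (conePushforward P).map Cone.atoms = P := by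
  rw [conePushforward, Measure.map_map measurable_atoms measurable_toCone]
  have h : Cone.atoms ∘ toCone = (Subtype.val : PinConfig X → Config (PosReal × X)) :=
    funext atoms_toCone
  rw [h]
  have hpin : NullMeasurableSet (pinpointing X) P :=
    (NullMeasurableSet.of_null hP).of_compl
  refine Measure.ext fun S hS => ?_
  rw [Measure.map_apply measurable_subtype_coe hS, Measure.comap_apply₀ _ _ Subtype.val_injective]
  · rw [Subtype.image_preimage_coe]
    refine measure_congr ?_
    filter_upwards [hP] with γ hγ
    exact propext ⟨fun h => h.2, fun h => ⟨hγ, h⟩⟩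
  · rintro _ ⟨T, hT, rfl⟩
    rw [Subtype.image_preimage_coe]
    exact hpin.inter hT.nullMeasurableSet
  · exact (measurable_subtype_coe hS).nullMeasurableSet

lemma lintegral_conePushforward {P : Measure (Config (PosReal × X))}
    (hP : ∀ᵐ γ ∂P, γ ∈ pinpointing X) {g : Config (PosReal × X) → ℝ≥0∞} (hg : Measurable g) :
    ∫⁻ η, g η.atoms ∂conePushforward P = ∫⁻ γ, g γ ∂P := by
  conv_rhs => rw [← map_atoms_conePushforward hP]
  rw [lintegral_map hg measurable_atoms]

lemma hasFiniteLocalMoments_conePushforward {ν : Measure PosReal} [IsFiniteMeasureOnCompacts ν]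
    [NullSingletonClass ν] {σ : Measure X} [IsFiniteMeasureOnCompacts σ] [NullSingletonClass σ]
    {P : Measure (Config (PosReal × X))} (hP : IsPoissonMeasure (ν.prod σ) P)
    (hν : ∀ n : ℕ, 1 ≤ n → ∫⁻ s, ENNReal.ofReal ((s : ℝ) ^ n) ∂ν < ∞) :
    HasFiniteLocalMoments (conePushforward P) := by
  have hpin := hP.ae_mem_pinpointing hν
  refine ⟨⟨?_⟩, fun n _ Λ hΛ => ?_⟩
  · have hprob := hP.1
    have h := lintegral_conePushforward hpin (measurable_one (α := ℝ≥0∞))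
    simpa using h
  · have h := lintegral_conePushforward hpin ((measurable_localMass hΛ.1).pow_const n)
    simp_rw [localMass_atoms _ hΛ.1] at h
    rw [h]
    exact hP.lintegral_localMass_pow_lt_top hν hΛ n

end Atoms

/-! ### Finite parts of discrete Radon measures -/

section FiniteParts

variable {X : Type*} [TopologicalSpace X] [PolishSpace X] [LocallyCompactSpace X]
  [MeasurableSpace X] [BorelSpace X]

lemma Cone.weight_of_mem_points {η : Cone X} {p : PosReal × X} (hp : p ∈ η.points) :
    η.weight p.2 = p.1 := by
  have : η.toMeasure {p.2} = ENNReal.ofReal p.1 := hp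
  rw [Cone.weight, this, ENNReal.toReal_ofReal p.1.2.le]

lemma Cone.supp_eq_image_points (η : Cone X) : η.supp = Prod.snd '' η.points := by
  refine Set.Subset.antisymm (supp_subset η.toMeasure_eq) ?_
  rintro _ ⟨p, hp, rfl⟩
  change 0 < η.weight p.2
  rw [Cone.weight_of_mem_points hp]
  exact p.1.2

lemma Cone.ncard_supp (η : Cone X) : η.supp.ncard = η.points.ncard := by
  rw [η.supp_eq_image_points, η.injOn_points.ncard_image]

lemma Cone.ext_points {η η' : Cone X} (h : η.points = η'.points) : η = η' := by
  refine Cone.ext ?_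
  rw [η.toMeasure_eq, η'.toMeasure_eq, h]

lemma FinCone.ext_points {ξ ξ' : FinCone X} (h : ξ.toCone.points = ξ'.toCone.points) : ξ = ξ' := by
  cases ξ
  cases ξ'
  congr
  exact Cone.ext_points h

lemma FinCone.finite_points (ξ : FinCone X) : ξ.toCone.points.Finite := by
  have h := ξ.finite
  rw [ξ.toCone.supp_eq_image_points] at h
  exact h.of_finite_image ξ.toCone.injOn_points

lemma isPart_iff {ξ : FinCone X} {η : Cone X} : IsPart ξ η ↔ ξ.toCone.points ⊆ η.points := by
  constructor
  · rintro ⟨hsupp, hw⟩ p hp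
    have hx : p.2 ∈ ξ.toCone.supp := by
      rw [Cone.supp_eq_image_points]; exact ⟨p, hp, rfl⟩
    have h := hsupp hx
    rw [Cone.supp_eq_image_points] at h
    obtain ⟨q, hq, hqp⟩ := h
    have h1 := hw _ hx
    rw [Cone.weight_of_mem_points hp, ← hqp, Cone.weight_of_mem_points hq] at h1
    rwa [Prod.ext (Subtype.ext h1) hqp.symm]
  · intro h
    refine ⟨?_, fun x hx => ?_⟩
    · rw [Cone.supp_eq_image_points, Cone.supp_eq_image_points]
      exact Set.image_mono h
    · rw [Cone.supp_eq_image_points] at hx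
      obtain ⟨p, hp, rfl⟩ := hx
      rw [Cone.weight_of_mem_points hp, Cone.weight_of_mem_points (h hp)]

lemma points_ofTuple {n : ℕ} {y : Fin n → PosReal × X}
    (hy : Function.Injective fun i => (y i).2) :
    (FinCone.ofTuple y).toCone.points = Set.range y := by
  refine Cone.points_eq ?_ (Measure.ext fun B hB => ?_)
  · rintro _ ⟨i, rfl⟩ _ ⟨j, rfl⟩ h
    rw [hy h]
  · have hy' : Function.Injective y := fun i j h => hy (congrArg Prod.snd h)
    rw [weightedSum_apply _ hB, ← (Equiv.ofInjective y hy').tsum_eq, tsum_fintype]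
    simp [FinCone.ofTuple, Measure.dirac_apply' _ hB]

lemma atoms_mem_pinpointing (η : Cone X) : η.atoms ∈ pinpointing X := by
  refine ⟨fun p hp q hq h => congrArg Prod.fst (η.injOn_points hp hq h), fun Λ hΛ => ?_⟩
  rw [localMass_atoms η hΛ.1]
  exact hΛ.measure_lt_top _

/-- The tuples of points with distinct positions that represent an element of `A`. -/
def tupleSet (A : Set (FinCone X)) (n : ℕ) : Set (Fin n → PosReal × X) :=
  {y | (Function.Injective fun i => (y i).2) ∧ FinCone.ofTuple y ∈ A}

lemma exists_toFinCone_eq_ofTuple {n : ℕ} {y : Fin n → PosReal × X} (hy : Function.Injective y)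
    (hx : Function.Injective fun i => (y i).2) :
    ∃ h : (FinConfig.ofTuple ⟨n, y, hy⟩).toConfig ∈ pinpointing X,
      toFinCone ⟨FinConfig.ofTuple ⟨n, y, hy⟩, h⟩ = FinCone.ofTuple y := by
  have h1 : (FinCone.ofTuple y).toCone.atoms = (FinConfig.ofTuple ⟨n, y, hy⟩).toConfig :=
    Config.ext (points_ofTuple hx)
  have h2 : (FinConfig.ofTuple ⟨n, y, hy⟩).toConfig ∈ pinpointing X :=
    h1 ▸ atoms_mem_pinpointing _
  refine ⟨h2, FinCone.ext_points ?_⟩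
  rw [points_ofTuple hx]
  exact congrArg Config.carrier (atoms_toCone ⟨_, h2⟩)

lemma measurableSet_tupleSet {A : Set (FinCone X)} (hA : MeasurableSet A) (n : ℕ) :
    MeasurableSet (tupleSet A n) := by
  obtain ⟨B, hB, hAB⟩ : ∃ B : Set (FinConfig (PosReal × X)), MeasurableSet B ∧
      Subtype.val ⁻¹' B = (toFinCone : FinPinConfig X → FinCone X) ⁻¹' A := hA
  have hc : Continuous fun y : {y : Fin n → PosReal × X // Function.Injective y} =>
      FinConfig.ofTuple ⟨n, y⟩ := by
    have h : Continuous (FinConfig.ofTuple (Y := PosReal × X)) := continuous_coinduced_rng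
    exact h.comp continuous_sigmaMk
  have h : tupleSet A n = {y | Function.Injective fun i => (y i).2} ∩
      Subtype.val '' ((fun y : {y : Fin n → PosReal × X // Function.Injective y} =>
        FinConfig.ofTuple ⟨n, y⟩) ⁻¹' B) := by
    ext y
    refine and_congr_right fun hx => ?_
    have hy : Function.Injective y := fun i j h => hx (congrArg Prod.snd h)
    obtain ⟨h1, h2⟩ := exists_toFinCone_eq_ofTuple hy hx
    have h3 := Set.ext_iff.1 hAB ⟨_, h1⟩
    rw [Set.mem_preimage, Set.mem_preimage, h2] at h3
    rw [← h3]
    constructor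
    · exact fun h => ⟨⟨y, hy⟩, h, rfl⟩
    · rintro ⟨⟨_, _⟩, h, rfl⟩
      exact h
  rw [h]
  exact (measurableSet_injective_comp measurable_snd n).inter
    ((measurableSet_injective n).subtype_image (hc.measurable hB))

/-! ### The Lebesgue-Poisson measure -/

section LebesguePoisson

variable {ν : Measure PosReal} [IsFiniteMeasureOnCompacts ν]
    {σ : Measure X} [IsFiniteMeasureOnCompacts σ] [NullSingletonClass σ]

lemma ae_injective_snd (n : ℕ) : ∀ᵐ y ∂Measure.pi fun _ : Fin n => ν.prod σ,
    Function.Injective fun i => (y i).2 :=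
  ae_pi_injective (ν.prod σ) measurable_snd (prod_preimage_snd_singleton ν σ) n

lemma aemeasurable_ofTuple (n : ℕ) :
    AEMeasurable (FinCone.ofTuple : (Fin n → PosReal × X) → FinCone X)
      (Measure.pi fun _ : Fin n => ν.prod σ) := by
  classical
  have hD : MeasurableSet {y : Fin n → PosReal × X | Function.Injective fun i => (y i).2} :=
    measurableSet_injective_comp measurable_snd n
  refine ⟨fun y => if Function.Injective fun i => (y i).2 then FinCone.ofTuple y
    else FinCone.ofTuple (Fin.elim0 : Fin 0 → PosReal × X), fun A hA => ?_, ?_⟩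
  · by_cases h0 : FinCone.ofTuple (Fin.elim0 : Fin 0 → PosReal × X) ∈ A
    · convert (measurableSet_tupleSet hA n).union hD.compl using 1
      ext y
      by_cases hy : Function.Injective fun i => (y i).2 <;> simp [hy, tupleSet, h0]
    · convert measurableSet_tupleSet hA n using 1
      ext y
      by_cases hy : Function.Injective fun i => (y i).2 <;> simp [hy, tupleSet, h0]
  · filter_upwards [ae_injective_snd n] with y hy
    rw [if_pos hy]

lemma lebesguePoisson_apply {A : Set (FinCone X)} (hA : MeasurableSet A) :
    lebesguePoisson ν σ A = ∑' n : ℕ, (n.factorial : ℝ≥0∞)⁻¹ *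
      (Measure.pi fun _ : Fin n => ν.prod σ) (tupleSet A n) := by
  rw [lebesguePoisson, Measure.sum_apply _ hA]
  refine tsum_congr fun n => ?_
  rw [Measure.smul_apply, Measure.map_apply_of_aemeasurable (aemeasurable_ofTuple n) hA,
    smul_eq_mul]
  congr 1
  refine measure_congr ?_
  filter_upwards [ae_injective_snd n] with y hy
  exact propext ⟨fun h => ⟨hy, h⟩, fun h => h.2⟩

lemma isCompact_weights (a b : ℝ) (ha : 0 < a) :
    IsCompact {s : PosReal | (s : ℝ) ∈ Set.Icc a b} := by
  rw [Subtype.isCompact_iff]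
  convert isCompact_Icc (a := a) (b := b) using 1
  ext s
  simp only [Set.mem_image, Set.mem_ofPred_eq, Subtype.exists, exists_and_right, exists_eq_right]
  exact ⟨fun h => h.2, fun h => ⟨ha.trans_le h.1, h⟩⟩

lemma lebesguePoisson_lt_top {A : Set (FinCone X)} (hA : IsBoundedSet A) :
    lebesguePoisson ν σ A < ∞ := by
  obtain ⟨hAm, a, b, Λ, N, ha, -, hΛ, h⟩ := hA
  rw [lebesguePoisson_apply hAm]
  have hsub : ∀ n, tupleSet A n ⊆ Set.univ.pi fun _ : Fin n =>
      {s : PosReal | (s : ℝ) ∈ Set.Icc a b} ×ˢ closure Λ := by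
    rintro n y ⟨hx, hyA⟩ i -
    obtain ⟨h1, -, h2⟩ := h _ hyA
    have hi : y i ∈ (FinCone.ofTuple y).toCone.points := by
      rw [points_ofTuple hx]; exact ⟨i, rfl⟩
    have hs : (y i).2 ∈ (FinCone.ofTuple y).toCone.supp := by
      rw [Cone.supp_eq_image_points]; exact ⟨_, hi, rfl⟩
    have h3 := h2 _ hs
    rw [Cone.weight_of_mem_points hi] at h3
    exact ⟨h3, subset_closure (h1 hs)⟩
  have hempty : ∀ n, N < n → tupleSet A n = ∅ := by
    intro n hn
    refine Set.eq_empty_iff_forall_notMem.2 ?_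
    rintro y ⟨hx, hyA⟩
    have h1 := (h _ hyA).2.1
    rw [Cone.ncard_supp, points_ofTuple hx, Set.ncard_range_of_injective
      fun i j h => hx (congrArg Prod.snd h), Nat.card_eq_fintype_card, Fintype.card_fin] at h1
    omega
  rw [tsum_eq_sum (s := Finset.range (N + 1)) fun n hn => by
    rw [hempty n (by simpa using hn), measure_empty, mul_zero]]
  refine ENNReal.sum_lt_top.2 fun n _ => ENNReal.mul_lt_top ?_ ?_
  · exact ENNReal.inv_lt_top.2 (by exact_mod_cast n.factorial_pos)
  · refine (measure_mono (hsub n)).trans_lt ?_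
    rw [Measure.pi_pi]
    exact ENNReal.prod_lt_top fun _ _ =>
      ((isCompact_weights a b ha).prod hΛ.2).measure_lt_top

end LebesguePoisson

/-! ### The `K`-transform -/

section KTransform

/-- The finite parts of `η` with `n` atoms, counted with the orderings of their atoms, are the
`n`-tuples of distinct points of `R⁻¹ η`. -/
lemma factorialMeasure_atoms_tupleSet (η : Cone X) {A : Set (FinCone X)} (hA : MeasurableSet A)
    (n : ℕ) : η.atoms.factorialMeasure n (tupleSet A n) = n.factorial *
      (ENat.card {ξ : {ξ : FinCone X // IsPart ξ η ∧ ξ ∈ A} //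
        ξ.1.toCone.points.ncard = n} : ℝ≥0∞) := by
  set T := {y ∈ tupleSet A n | Function.Injective y ∧ ∀ i, y i ∈ η.atoms.carrier} with hT
  let Q := {ξ : {ξ : FinCone X // IsPart ξ η ∧ ξ ∈ A} // ξ.1.toCone.points.ncard = n}
  have hrange : ∀ (ξ : Q) (e : Fin n ≃ ξ.1.1.toCone.points),
      Set.range (fun i => (e i : PosReal × X)) = ξ.1.1.toCone.points := fun ξ e => by
    rw [Set.range_comp' Subtype.val e, e.range_eq_univ, Set.image_univ, Subtype.range_coe]
  have hinj : ∀ (ξ : Q) (e : Fin n ≃ ξ.1.1.toCone.points),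
      Function.Injective fun i => (e i : PosReal × X).2 := fun ξ e i j h =>
    e.injective (Subtype.ext (ξ.1.1.toCone.injOn_points (e i).2 (e j).2 h))
  have hof : ∀ (ξ : Q) (e : Fin n ≃ ξ.1.1.toCone.points),
      FinCone.ofTuple (fun i => (e i : PosReal × X)) = ξ.1.1 := fun ξ e =>
    FinCone.ext_points ((points_ofTuple (hinj ξ e)).trans (hrange ξ e))
  let F : (Σ ξ : Q, Fin n ≃ ξ.1.1.toCone.points) → T := fun q =>
    ⟨fun i => (q.2 i : PosReal × X), ⟨hinj q.1 q.2, by rw [hof]; exact q.1.1.2.2⟩,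
      fun i j h => q.2.injective (Subtype.ext h),
      fun i => isPart_iff.1 q.1.1.2.1 (q.2 i).2⟩
  have hF : Function.Bijective F := by
    constructor
    · rintro ⟨ξ, e⟩ ⟨ξ', e'⟩ h
      have h1 : (fun i => (e i : PosReal × X)) = fun i => (e' i : PosReal × X) :=
        congrArg Subtype.val h
      have h2 : ξ = ξ' := by
        refine Subtype.ext (Subtype.ext ?_)
        rw [← hof ξ e, ← hof ξ' e', h1]
      subst h2
      have h3 : e = e' := Equiv.ext fun i => Subtype.ext (congrFun h1 i)
      rw [h3]
    · rintro ⟨y, ⟨hx, hyA⟩, hy, hyη⟩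
      have hp := points_ofTuple hx
      have hpart : IsPart (FinCone.ofTuple y) η := by
        rw [isPart_iff, hp]
        rintro _ ⟨i, rfl⟩
        exact hyη i
      refine ⟨⟨⟨⟨FinCone.ofTuple y, hpart, hyA⟩, ?_⟩,
        (Equiv.ofInjective y hy).trans (Equiv.setCongr hp.symm)⟩, ?_⟩
      · rw [hp, Set.ncard_range_of_injective hy, Nat.card_eq_fintype_card, Fintype.card_fin]
      · exact Subtype.ext rfl
  have hcard : ∀ ξ : Q, (ENat.card (Fin n ≃ ξ.1.1.toCone.points) : ℝ≥0∞) = n.factorial := by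
    intro ξ
    classical
    have : Finite ξ.1.1.toCone.points := ξ.1.1.finite_points
    let := Fintype.ofFinite ξ.1.1.toCone.points
    have e : Fin n ≃ ξ.1.1.toCone.points := (Finite.equivFinOfCardEq ξ.2).symm
    rw [ENat.card_eq_coe_fintype_card, Fintype.card_equiv e, Fintype.card_fin]
    simp
  rw [η.atoms.factorialMeasure_apply n (measurableSet_tupleSet hA n), ← hT,
    ← ENNReal.tsum_set_one, ← (Equiv.ofBijective F hF).tsum_eq, ENNReal.tsum_sigma']
  simp_rw [ENNReal.tsum_const, mul_one, hcard]
  rw [ENNReal.tsum_const, mul_comm]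

/-- The number of tuples of points of a configuration that represent an element of `A`, each
counted up to the order of its entries. -/
noncomputable def partCount (A : Set (FinCone X)) (γ : Config (PosReal × X)) : ℝ≥0∞ :=
  ∑' n : ℕ, (n.factorial : ℝ≥0∞)⁻¹ * γ.factorialMeasure n (tupleSet A n)

lemma measurable_partCount {A : Set (FinCone X)} (hA : MeasurableSet A) :
    Measurable (partCount A) :=
  Measurable.tsum fun n => ((Measure.measurable_coe (measurableSet_tupleSet hA n)).comp
    (measurable_factorialMeasure n)).const_mul _

lemma partCount_atoms (η : Cone X) {A : Set (FinCone X)} (hA : MeasurableSet A) :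
    partCount A η.atoms = {ξ : FinCone X | IsPart ξ η ∧ ξ ∈ A}.encard := by
  have hterm : ∀ n : ℕ, (n.factorial : ℝ≥0∞)⁻¹ * η.atoms.factorialMeasure n (tupleSet A n) =
      ∑' _ : {ξ : {ξ : FinCone X // IsPart ξ η ∧ ξ ∈ A} // ξ.1.toCone.points.ncard = n}, 1 :=
    fun n => by
      rw [factorialMeasure_atoms_tupleSet η hA, ← mul_assoc, ENNReal.inv_mul_cancel
        (by exact_mod_cast n.factorial_ne_zero) (ENNReal.natCast_ne_top _), one_mul,
        ENNReal.tsum_const, mul_one]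
  rw [partCount]
  simp_rw [hterm]
  rw [← ENNReal.tsum_sigma' fun _ => 1, ← ENNReal.tsum_set_one]
  exact (Equiv.sigmaFiberEquiv fun ξ : {ξ : FinCone X // IsPart ξ η ∧ ξ ∈ A} =>
    ξ.1.toCone.points.ncard).tsum_eq fun _ => (1 : ℝ≥0∞)

lemma kTransform_indicator (A : Set (FinCone X)) (η : Cone X) :
    kTransform (A.indicator 1) η = ({ξ : FinCone X | IsPart ξ η ∧ ξ ∈ A}.ncard : ℝ) := by
  classical
  have h1 : kTransform (A.indicator 1) η =
      ∑ᶠ ξ ∈ {ξ : FinCone X | IsPart ξ η ∧ ξ ∈ A}, (1 : ℝ) := by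
    rw [kTransform, finsum_mem_def, finsum_mem_def, Set.indicator_indicator]
    rfl
  rw [h1]
  rcases {ξ : FinCone X | IsPart ξ η ∧ ξ ∈ A}.finite_or_infinite with hfin | hinf
  · rw [finsum_mem_eq_finite_toFinset_sum _ hfin, Set.ncard_eq_toFinset_card _ hfin]
    simp
  · -- Both sides have the value `0` by convention.
    rw [hinf.ncard, finsum_mem_eq_zero_of_infinite (by simpa [Function.support_const] using hinf)]
    simp

lemma kTransform_indicator_eq_toReal (η : Cone X) {A : Set (FinCone X)} (hA : MeasurableSet A) :
    kTransform (A.indicator 1) η = (partCount A η.atoms).toReal := by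
  rw [kTransform_indicator, partCount_atoms η hA, Set.ncard_def]
  generalize Set.encard _ = k
  cases k using ENat.recTopCoe <;> simp

variable {ν : Measure PosReal} [IsFiniteMeasureOnCompacts ν] [NullSingletonClass ν]
    {σ : Measure X} [IsFiniteMeasureOnCompacts σ] [NullSingletonClass σ]
    {P : Measure (Config (PosReal × X))}

lemma IsPoissonMeasure.lintegral_partCount (hP : IsPoissonMeasure (ν.prod σ) P)
    {A : Set (FinCone X)} (hA : MeasurableSet A) :
    ∫⁻ γ, partCount A γ ∂P = lebesguePoisson ν σ A := by
  have hm : ∀ n, Measurable fun γ : Config (PosReal × X) =>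
      γ.factorialMeasure n (tupleSet A n) := fun n =>
    (Measure.measurable_coe (measurableSet_tupleSet hA n)).comp (measurable_factorialMeasure n)
  rw [lebesguePoisson_apply hA]
  simp_rw [partCount]
  rw [lintegral_tsum fun n => ((hm n).const_mul _).aemeasurable]
  refine tsum_congr fun n => ?_
  rw [lintegral_const_mul _ (hm n), ← hP.bind_factorialMeasure,
    Measure.bind_apply (measurableSet_tupleSet hA n) (measurable_factorialMeasure n).aemeasurable]

lemma isCorrelationMeasure_lebesguePoisson (hP : IsPoissonMeasure (ν.prod σ) P)
    (hν : ∀ n : ℕ, 1 ≤ n → ∫⁻ s, ENNReal.ofReal ((s : ℝ) ^ n) ∂ν < ∞) :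
    IsCorrelationMeasure (conePushforward P) (lebesguePoisson ν σ) := by
  intro A hA
  have hm : Measurable fun η : Cone X => partCount A η.atoms :=
    (measurable_partCount hA.1).comp measurable_atoms
  have hint : ∫⁻ η, partCount A η.atoms ∂conePushforward P = lebesguePoisson ν σ A := by
    rw [lintegral_conePushforward (hP.ae_mem_pinpointing hν) (measurable_partCount hA.1),
      hP.lintegral_partCount hA.1]
  have hfin := lebesguePoisson_lt_top (ν := ν) (σ := σ) hA
  have hK : kTransform (A.indicator 1) = fun η : Cone X => (partCount A η.atoms).toReal :=
    funext fun η => kTransform_indicator_eq_toReal η hA.1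
  rw [hK]
  refine ⟨integrable_toReal_of_lintegral_ne_top hm.aemeasurable (hint ▸ hfin.ne), ?_⟩
  rw [integral_toReal hm.aemeasurable (ae_lt_top hm (hint ▸ hfin.ne)), hint,
    ENNReal.ofReal_toReal hfin.ne]

end KTransform

/-! ### Uniqueness of correlation measures -/

section Uniqueness

/-- The set of all `ξ` with at most `k` atoms, all of them in the `k`-th set of an exhaustion and
with weights in `[1 / (k + 1), k + 2]`. -/
def exhaustingSet (K : CompactExhaustion X) (k : ℕ) : Set (FinCone X) :=
  {ξ | (∀ p ∈ ξ.toCone.points, (p.1 : ℝ) ∈ Set.Icc (1 / ((k : ℝ) + 1)) (k + 2) ∧ p.2 ∈ K k) ∧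
    ξ.toCone.points.ncard ≤ k}

/-- The configurations corresponding to an exhausting set form a closed set. -/
lemma measurableSet_exhaustingSet (K : CompactExhaustion X) (k : ℕ) :
    MeasurableSet (exhaustingSet K k) := by
  let C : Set (PosReal × X) :=
    {p | (p.1 : ℝ) ∈ Set.Icc (1 / ((k : ℝ) + 1)) (k + 2) ∧ p.2 ∈ K k}
  have hC : IsClosed C :=
    (isClosed_Icc.preimage (continuous_subtype_val.comp continuous_fst)).inter
      ((K.isCompact k).isClosed.preimage continuous_snd)
  let B : Set (FinConfig (PosReal × X)) :=
    {c | c.toConfig.carrier ⊆ C ∧ c.toConfig.carrier.ncard ≤ k}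
  have hB : IsClosed B := by
    rw [isClosed_coinduced, isClosed_sigma_iff]
    intro n
    by_cases hn : n ≤ k
    · have : Sigma.mk n ⁻¹' (FinConfig.ofTuple ⁻¹' B) =
          ⋂ i, {y : {y : Fin n → PosReal × X // Function.Injective y} | y.1 i ∈ C} := by
        ext y
        have hcard : (Set.range y.1).ncard ≤ k := by
          rw [Set.ncard_range_of_injective y.2, Nat.card_eq_fintype_card, Fintype.card_fin]
          exact hn
        simp only [Set.mem_iInter]
        exact ⟨fun h i => h.1 ⟨i, rfl⟩, fun h => ⟨Set.range_subset_iff.2 h, hcard⟩⟩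
      rw [this]
      exact isClosed_iInter fun i =>
        hC.preimage ((continuous_apply i).comp continuous_subtype_val)
    · have : Sigma.mk n ⁻¹' (FinConfig.ofTuple ⁻¹' B) = ∅ := by
        refine Set.eq_empty_iff_forall_notMem.2 fun y hy => hn ?_
        have h : (Set.range y.1).ncard ≤ k := hy.2
        rwa [Set.ncard_range_of_injective y.2, Nat.card_eq_fintype_card, Fintype.card_fin] at h
      rw [this]
      exact isClosed_empty
  refine ⟨B, hB.measurableSet, ?_⟩
  ext γ
  have h : (toFinCone γ).toCone.points = γ.1.toConfig.carrier :=
    congrArg Config.carrier (atoms_toCone ⟨γ.1.toConfig, γ.2⟩)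
  simp only [Set.mem_preimage, exhaustingSet, Set.mem_ofPred_eq, h]
  exact Iff.rfl

lemma isBoundedSet_inter_exhaustingSet (K : CompactExhaustion X) (k : ℕ) {A : Set (FinCone X)}
    (hA : MeasurableSet A) : IsBoundedSet (A ∩ exhaustingSet K k) := by
  refine ⟨hA.inter (measurableSet_exhaustingSet K k), 1 / ((k : ℝ) + 1), k + 2, K k, k,
    by positivity, ?_, (K.isCompact k).isRelCompactBorel, ?_⟩
  · rw [div_lt_iff₀ (by positivity)]
    nlinarith [(Nat.cast_nonneg k : (0 : ℝ) ≤ k)]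
  · rintro ξ ⟨-, h1, h2⟩
    rw [← Cone.ncard_supp] at h2
    rw [ξ.toCone.supp_eq_image_points] at h2 ⊢
    refine ⟨?_, h2, ?_⟩
    · rintro _ ⟨p, hp, rfl⟩
      exact (h1 p hp).2
    · rintro _ ⟨p, hp, rfl⟩
      rw [Cone.weight_of_mem_points hp]
      exact (h1 p hp).1

lemma monotone_exhaustingSet (K : CompactExhaustion X) : Monotone (exhaustingSet K) := by
  rintro k l hkl ξ ⟨h1, h2⟩
  have hkl' : (k : ℝ) ≤ l := by exact_mod_cast hkl
  refine ⟨fun p hp => ⟨⟨?_, ?_⟩, K.subset hkl (h1 p hp).2⟩, h2.trans hkl⟩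
  · refine le_trans ?_ (h1 p hp).1.1
    gcongr
  · exact (h1 p hp).1.2.trans (by linarith)

lemma iUnion_exhaustingSet (K : CompactExhaustion X) : ⋃ k, exhaustingSet K k = Set.univ := by
  refine Set.eq_univ_of_forall fun ξ => ?_
  have hfin := ξ.finite_points
  -- Each of the finitely many constraints holds for all large `k`.
  have h1 : ∀ᶠ k : ℕ in atTop, ∀ p ∈ ξ.toCone.points,
      (p.1 : ℝ) ∈ Set.Icc (1 / ((k : ℝ) + 1)) (k + 2) ∧ p.2 ∈ K k := by
    refine hfin.eventually_all.2 fun p _ => ?_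
    have ha : ∀ᶠ k : ℕ in atTop, 1 / ((k : ℝ) + 1) < p.1 :=
      tendsto_one_div_add_atTop_nhds_zero_nat.eventually_lt_const p.1.2
    have hb : ∀ᶠ k : ℕ in atTop, (p.1 : ℝ) ≤ k := tendsto_natCast_atTop_atTop.eventually_ge_atTop _
    obtain ⟨N, hN⟩ := K.exists_mem p.2
    filter_upwards [ha, hb, eventually_ge_atTop N] with k hka hkb hkN
    exact ⟨⟨hka.le, by linarith⟩, K.subset hkN hN⟩
  obtain ⟨k, hk1, hk2⟩ := (h1.and (eventually_ge_atTop ξ.toCone.points.ncard)).exists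
  exact Set.mem_iUnion.2 ⟨k, hk1, hk2⟩

/-- Correlation measures are unique, since every measurable set is an increasing union of bounded
sets. -/
lemma IsCorrelationMeasure.unique {μ : Measure (Cone X)} {ρ ρ' : Measure (FinCone X)}
    (h : IsCorrelationMeasure μ ρ) (h' : IsCorrelationMeasure μ ρ') : ρ = ρ' := by
  let K := CompactExhaustion.choice X
  refine Measure.ext fun A hA => ?_
  have hU : A = ⋃ k, A ∩ exhaustingSet K k := by
    rw [← Set.inter_iUnion, iUnion_exhaustingSet, Set.inter_univ]
  have hmono : Monotone fun k => A ∩ exhaustingSet K k := fun k l hkl =>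
    Set.inter_subset_inter_right _ (monotone_exhaustingSet K hkl)
  rw [hU, hmono.measure_iUnion, hmono.measure_iUnion]
  refine iSup_congr fun k => ?_
  have hb := isBoundedSet_inter_exhaustingSet K k hA
  rw [(h _ hb).2, (h' _ hb).2]

end Uniqueness

end FiniteParts

end RadonCone

theorem mainTheorem2 {X : Type*} [TopologicalSpace X] [PolishSpace X] [LocallyCompactSpace X]
    [MeasurableSpace X] [BorelSpace X]
    (ν : Measure RadonCone.PosReal) [IsFiniteMeasureOnCompacts ν] [NullSingletonClass ν]
    (σ : Measure X) [IsFiniteMeasureOnCompacts σ] [NullSingletonClass σ]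
    (hν : ∀ n : ℕ, 1 ≤ n → ∫⁻ s, ENNReal.ofReal ((s : ℝ) ^ n) ∂ν < ∞)
    (P : Measure (RadonCone.Config (RadonCone.PosReal × X)))
    (hP : RadonCone.IsPoissonMeasure (ν.prod σ) P) :
    RadonCone.HasFiniteLocalMoments (RadonCone.conePushforward P) ∧
      RadonCone.IsCorrelationMeasure (RadonCone.conePushforward P)
        (RadonCone.lebesguePoisson ν σ) ∧
      ∀ ρ : Measure (RadonCone.FinCone X),
        RadonCone.IsCorrelationMeasure (RadonCone.conePushforward P) ρ →
          ρ = RadonCone.lebesguePoisson ν σ := by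
  exact ⟨RadonCone.hasFiniteLocalMoments_conePushforward hP hν,
      RadonCone.isCorrelationMeasure_lebesguePoisson hP hν,
      fun _ hρ => hρ.unique (RadonCone.isCorrelationMeasure_lebesguePoisson hP hν)⟩
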